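/- Conventions. For a valued field $K$ with valuation ring $\mathcal O$, write $v:K\to\Gamma\cup\{\infty\}$ for the (additive) valuation with value group $\Gamma=v(K^\times)$, and $f\preccurlyeq g:\Leftrightarrow v f\ge v g$, $f\prec g:\Leftrightarrow v f>v g$. In a differential field write $a'$ for the derivative and, for $a\ne 0$, $a^\dagger:=a'/a$. An \emph{asymptotic field} is a differential field $K$ of characteristic $0$ with a valuation ring $\mathcal O\supseteq\mathbb Q$ such that for all nonzero $f,g\prec 1$ one has $f\prec g\Leftrightarrow f'\prec g'$. Then $\psi(v g):=v(g^\dagger)$ (for $g\neq 0$, $v g\ne 0$) defines a map $\psi:\Gamma\setminus\{0\}\to\Gamma$; put $\Psi:=\psi(\Gamma\setminus\{0\})$ and $(\Gamma^{<})':=\{\gamma+\psi(\gamma):\gamma\in\Gamma,\ \gamma<0\}$. The asymptotic field $K$ is \emph{$H$-asymptotic} (of \emph{$H$-type}) if $0<\alpha\le\beta$ in $\Gamma$ implies $\psi(\alpha)\ge\psi(\beta)$; it is \emph{ungrounded} if $\Psi$ has no largest element; it is \emph{pre-$\mathrm d$-valued} if $f'\prec g^\dagger$ for all nonzero $f\preccurlyeq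 1$ and $g\prec 1$. An $H$-asymptotic field $K$ is \emph{$\lambda$-free} if it is ungrounded, $\Gamma\ne\{0\}$, and for every $s\in K$ there is $g\in K$ with $g\succ 1$ and $s-g^{\dagger\dagger}\succcurlyeq g^\dagger$. \textbf{Proposition.} Let $K$ be a henselian pre-$\mathrm d$-valued field of $H$-type and let $s\in K$ be such that $$\{v(s-a'):a\in K\}\subseteq(\Gamma^{<})'.$$ Let $L=K(y)$ be a field extension of $K$ with $y$ transcendental over $K$, equipped with the derivation extending that of $K$ such that $y'=s$, and with a valuation making $L$ an $H$-asymptotic extension of $K$. Then $L$ is an immediate extension of $K$ with $y\succ 1$, and if $K$ is $\lambda$-free, then so is $L=K(y)$. -/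

import Mathlib

open scoped Differential

section ValuedDifferentialFields

variable {K : Type*} [Field K]

/-- `Γ_∞ = Γ ∪ {∞}` for the (additively written) value group `Γ` of a valuation ring `O` of `K`;
`⊤` is `∞`. -/
abbrev ValGrpTop (O : ValuationSubring K) : Type _ := (Additive O.ValueGroup)ᵒᵈ

/-- The (additive, surjective) valuation `v : K → Γ_∞` of a valuation ring, with `v 0 = ∞`.
So `f ≼ g` is `valn O g ≤ valn O f` and `f ≺ g` is `valn O g < valn O f`. -/
noncomputable def valn (O : ValuationSubring K) : AddValuation K (ValGrpTop O) :=
  O.valuation.toAddValuation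

theorem val_surjective (O : ValuationSubring K) : Function.Surjective (valn O) := fun γ => by
  obtain ⟨a, ha⟩ := O.valuation_surjective (Additive.toMul (OrderDual.ofDual γ))
  exact ⟨a, by rw [valn, Valuation.toAddValuation_apply, ha]; rfl⟩

theorem val_inv (O : ValuationSubring K) {f : K} (hf : f ≠ 0) : valn O f⁻¹ + valn O f = 0 := by
  rw [← AddValuation.map_mul, inv_mul_cancel₀ hf, AddValuation.map_one]

theorem val_ne_top (O : ValuationSubring K) {f : K} (hf : f ≠ 0) : valn O f ≠ ⊤ :=
  fun h => hf ((AddValuation.top_iff _).1 h)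

variable [Differential K]

/-- `K`, with the derivation `′` and the valuation ring `O`, is an asymptotic field: a differential
field of characteristic zero with a valuation ring containing `ℚ` such that
`f ≺ g ↔ f′ ≺ g′` for all nonzero `f, g ≺ 1`. -/
structure IsAsymptoticField (O : ValuationSubring K) : Prop where
  charZero : CharZero K
  rat_mem : ∀ q : ℚ, (q : K) ∈ O
  asymp : ∀ f g : K, f ≠ 0 → g ≠ 0 → 0 < valn O f → 0 < valn O g →
    (valn O g < valn O f ↔ valn O g′ < valn O f′)

open Classical in
/-- The map `ψ` of the asymptotic couple `(Γ, ψ)` of an asymptotic field: `ψ (v g) = v (g′ / g)`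
for nonzero `g` with `v g ≠ 0`, and `ψ 0 = ∞`. -/
noncomputable def psi (O : ValuationSubring K) (γ : ValGrpTop O) : ValGrpTop O :=
  if γ = 0 then ⊤ else valn O (Differential.logDeriv (val_surjective O γ).choose)

theorem val_logDeriv (O : ValuationSubring K) {f : K} (hf : f ≠ 0) :
    valn O (Differential.logDeriv f) + valn O f = valn O f′ := by
  rw [← AddValuation.map_mul, Differential.logDeriv, div_mul_cancel₀ _ hf]

theorem val_logDeriv_inv (O : ValuationSubring K) (f : K) :
    valn O (Differential.logDeriv f⁻¹) = valn O (Differential.logDeriv f) := by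
  rcases eq_or_ne f 0 with rfl | hf
  · simp
  · have h : Differential.logDeriv f⁻¹ = - Differential.logDeriv f := by
      have := Differential.logDeriv_div (1 : K) f one_ne_zero hf
      simpa using this
    rw [h, AddValuation.map_neg]

theorem IsAsymptoticField.val_logDeriv_congr {O : ValuationSubring K} (h : IsAsymptoticField O)
    {f g : K} (hf : f ≠ 0) (hg : g ≠ 0) (hv : valn O f = valn O g) (h0 : valn O f ≠ 0) :
    valn O (Differential.logDeriv f) = valn O (Differential.logDeriv g) := by
  have key : ∀ f g : K, f ≠ 0 → g ≠ 0 → valn O f = valn O g → 0 < valn O f →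
      valn O (Differential.logDeriv f) = valn O (Differential.logDeriv g) := by
    intro f g hf hg hv h0
    have h1 : valn O f′ = valn O g′ := by
      have a := h.asymp f g hf hg h0 (hv ▸ h0)
      have b := h.asymp g f hg hf (hv ▸ h0) h0
      rw [hv] at a b
      simp only [lt_self_iff_false, false_iff, not_lt] at a b
      exact le_antisymm a b
    rw [← val_logDeriv O hf, ← val_logDeriv O hg, hv] at h1
    have c := congrArg (· + valn O g⁻¹) h1
    simpa only [add_assoc, add_comm (valn O g) (valn O g⁻¹), val_inv O hg, add_zero] using c
  rcases lt_or_gt_of_ne h0 with hlt | hgt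
  · rw [← val_logDeriv_inv O f, ← val_logDeriv_inv O g]
    have hi : valn O f⁻¹ = valn O g⁻¹ := by
      rw [AddValuation.map_inv, AddValuation.map_inv, hv]
    refine key _ _ (inv_ne_zero hf) (inv_ne_zero hg) hi ?_
    by_contra hn
    have := val_inv O hf
    have h2 : valn O f⁻¹ + valn O f < 0 := by
      calc valn O f⁻¹ + valn O f ≤ 0 + valn O f := add_le_add_left (not_lt.1 hn) _
        _ < 0 := by rwa [zero_add]
    exact absurd this h2.ne
  · exact key f g hf hg hv hgt

/-- `ψ` does not depend on the choice of representatives. -/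
theorem IsAsymptoticField.psi_val {O : ValuationSubring K} (h : IsAsymptoticField O)
    {g : K} (hg : g ≠ 0) (h0 : valn O g ≠ 0) : psi O (valn O g) = valn O (Differential.logDeriv g) := by
  have hs := (val_surjective O (valn O g)).choose_spec
  rw [psi, if_neg h0]
  refine h.val_logDeriv_congr ?_ hg hs (by rwa [hs])
  intro hz
  rw [hz, AddValuation.map_zero] at hs
  exact val_ne_top O hg hs.symm

/-- `Ψ = {ψ(γ) : γ ∈ Γ, γ ≠ 0}`. -/
def PsiSet (O : ValuationSubring K) : Set (ValGrpTop O) :=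
  {β | ∃ γ : ValGrpTop O, γ ≠ 0 ∧ γ ≠ ⊤ ∧ β = psi O γ}

/-- `(Γ^<)′ = {γ + ψ(γ) : γ ∈ Γ, γ < 0}`. -/
def negDerived (O : ValuationSubring K) : Set (ValGrpTop O) :=
  {β | ∃ γ : ValGrpTop O, γ < 0 ∧ β = γ + psi O γ}

/-- The asymptotic couple is of `H`-type: `0 < α ≤ β` in `Γ` implies `ψ(α) ≥ ψ(β)`. -/
def IsHType (O : ValuationSubring K) : Prop :=
  ∀ α β : ValGrpTop O, 0 < α → α ≤ β → β ≠ ⊤ → psi O β ≤ psi O α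

/-- `H`-asymptotic fields: asymptotic fields of `H`-type. -/
structure IsHAsymptoticField (O : ValuationSubring K) : Prop extends IsAsymptoticField O where
  hType : IsHType O

/-- Pre-`d`-valued fields: asymptotic fields such that `f′ ≺ g′ / g` for all nonzero
`f ≼ 1` and `g ≺ 1`. -/
structure IsPreDValuedField (O : ValuationSubring K) : Prop extends IsAsymptoticField O where
  pdv : ∀ f g : K, f ≠ 0 → g ≠ 0 → 0 ≤ valn O f → 0 < valn O g →
    valn O (Differential.logDeriv g) < valn O f′

/-- The asymptotic couple is grounded: `Ψ` has a largest element. -/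
def IsGrounded (O : ValuationSubring K) : Prop :=
  ∃ γ, IsGreatest (PsiSet O) γ

/-- `λ`-freeness: an ungrounded `H`-asymptotic field with `Γ ≠ {0}` such that for all `s` there is
`g ≻ 1` with `s - g†† ≽ g†`, where `g† = g′ / g`. -/
structure IsLambdaFree (O : ValuationSubring K) : Prop extends IsHAsymptoticField O where
  ungrounded : ¬ IsGrounded O
  nontrivial : ∃ γ : ValGrpTop O, γ ≠ 0 ∧ γ ≠ ⊤
  lambdaFree : ∀ s : K, ∃ g : K, valn O g < 0 ∧
    valn O (s - Differential.logDeriv (Differential.logDeriv g)) ≤ valn O (Differential.logDeriv g)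

end ValuedDifferentialFields

/-- The valuation ring `OL` of `L` extends the valuation ring `OK` of `K`. -/
def ExtendsValuation {K L : Type*} [Field K] [Field L] [Algebra K L]
    (OK : ValuationSubring K) (OL : ValuationSubring L) : Prop :=
  ∀ a : K, algebraMap K L a ∈ OL ↔ a ∈ OK

/-- An extension `L` of valued fields is immediate: each element of the value group is the
valuation of an element of `K`, and each element of the residue field is the residue class of an
element of `K`. -/
structure IsImmediateExtension {K L : Type*} [Field K] [Field L] [Algebra K L]
    (OK : ValuationSubring K) (OL : ValuationSubring L) : Prop where
  extendsValuation : ExtendsValuation OK OL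
  valueGroup : ∀ f : L, f ≠ 0 → ∃ a : K, valn OL f = valn OL (algebraMap K L a)
  residueField : ∀ f : L, f ∈ OL → ∃ a ∈ OK, 0 < valn OL (f - algebraMap K L a)

/-! Fix a ∈ K. By hypothesis s - a′ ≍ b′ for some b ≻ 1 in K, and since (y - a)′ = s - a′, this
forces y - a ≍ b ≻ 1. Put u := (s - a′)/b′ ≍ 1. The corrected approximation a + ub leaves the
derivative -u′b, and u′ ≺ g† for all nonzero g ≭ 1 because K is pre-d-valued. So y has no best
approximation in K, and each one improves by a definite amount (`IsLargeIntegral.exists_better`).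

Since K is henselian of residue characteristic zero, every nonzero rational function F over K
satisfies F(a) ~ F(y) for a ∈ K close to y. The polynomial case is by induction on the degree: if P′
is nearly constant near y and P is not, Hensel's lemma gives a root of P in K, which can be split
off (`IsHenselianLimit.eventually_map_aeval_sub_lt`). Hence K(y) is immediate over K; y ≻ 1 is the
case a = 0 of the first step.

Suppose λ-freeness of K(y) fails at f = F(y). Then f - g†† ≺ g† for all g ≻ 1 in K, while λ-freeness
of K gives for each c ∈ K some g ≻ 1 with g† ≼ f - c. So f - F(a) gets below every g†, but for no
single a is it below all of them. Taylor expansion transfers this to y: the distances y - a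
eventually shrink by less than any factor e ≺ 1 (`IsHenselianLimit.eventually_jammed`). If all y - a
stay above some b ≻ 1, this contradicts the definite improvement. Otherwise y - a falls below every
b ≻ 1, and the size of the Taylor coefficients of F contradicts the absence of a gap in K
(`IsLargeIntegral.not_isLambdaLimit`). -/

open Polynomial Filter
open Differential (logDeriv)

/-! ### Hensel's lemma for non-monic polynomials with linear reduction -/

/-- In a henselian local ring, a (not necessarily monic) polynomial whose reduction is linear
has a root. -/
theorem HenselianLocalRing.exists_isRoot_of_coeff {R : Type*} [CommRing R] [HenselianLocalRing R]
    (Q : R[X]) (h1 : IsUnit (Q.coeff 1))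
    (h2 : ∀ i, 2 ≤ i → Q.coeff i ∈ IsLocalRing.maximalIdeal R) : ∃ z, Q.IsRoot z := by
  obtain ⟨u, hu⟩ := h1.exists_right_inv
  set S := Q.divX.divX with hS
  have hQ : Q = C (Q.coeff 0) + C (Q.coeff 1) * X + S * X ^ 2 := by
    conv_lhs => rw [← Q.divX_mul_X_add, ← Q.divX.divX_mul_X_add]
    rw [coeff_divX, hS]; ring
  set q0 := Q.coeff 0
  set q1 := Q.coeff 1
  have hSm : S.map (IsLocalRing.residue R) = 0 := by
    ext i
    rw [coeff_map, hS, coeff_divX, coeff_divX, coeff_zero, IsLocalRing.residue_eq_zero_iff]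
    exact h2 _ (by omega)
  -- Substituting X = -(q0 * u) * x gives Q = q0 * G(x), with G ≡ 1 - X modulo the maximal ideal.
  set G : R[X] := 1 - X + X ^ 2 * (C (q0 * u ^ 2) * S.comp (C (-(q0 * u)) * X)) with hG
  have hGm : G.map (IsLocalRing.residue R) = 1 - X := by
    simp [hG, Polynomial.map_comp, hSm]
  have hG0 : G.coeff 0 = 1 := by simp [hG]
  have hG1 : G.coeff 1 = -1 := by
    simp [hG, coeff_X_pow_mul', coeff_one]
  have hdeg : 1 ≤ G.natDegree := by
    refine le_natDegree_of_ne_zero ?_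
    rw [hG1]; simp
  -- G need not be monic, but its reverse is, because G(0) = 1. The reverse reduces to X ^ n - X ^
  -- (n - 1), which has 1 as a simple root; the lifted root is a unit, and its inverse is a root of
  -- G.
  have hmon : G.reverse.Monic := by
    rw [Monic, reverse_leadingCoeff, trailingCoeff,
      natTrailingDegree_eq_zero.2 (Or.inr (by rw [hG0]; exact one_ne_zero)), hG0]
  have hrm : G.reverse.map (IsLocalRing.residue R) = X ^ G.natDegree - X ^ (G.natDegree - 1) := by
    have h := reflect_monomial (R := IsLocalRing.ResidueField R) G.natDegree 1
    rw [revAt_le hdeg, pow_one] at h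
    rw [reverse, ← reflect_map, hGm, reflect_sub, reflect_one, h]
  have he : G.reverse.eval 1 ∈ IsLocalRing.maximalIdeal R := by
    rw [← IsLocalRing.residue_eq_zero_iff, ← eval_map_apply, hrm]
    simp
  have hd : IsUnit (G.reverse.derivative.eval 1) := by
    rw [← IsLocalRing.notMem_maximalIdeal, ← IsLocalRing.residue_eq_zero_iff, ← eval_map_apply,
      ← derivative_map, hrm]
    simp only [map_one, derivative_sub, derivative_X_pow, eval_sub, eval_mul, eval_pow,
      eval_X, one_pow, mul_one, eval_C, Nat.cast_sub hdeg, Nat.cast_one, sub_sub_cancel]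
    exact one_ne_zero (α := IsLocalRing.ResidueField R)
  obtain ⟨z, hz, hz1⟩ := HenselianLocalRing.is_henselian _ hmon 1 he hd
  have hzu : IsUnit z := by
    rw [← IsLocalRing.notMem_maximalIdeal, ← IsLocalRing.residue_eq_zero_iff]
    rw [← IsLocalRing.residue_eq_zero_iff, map_sub, map_one, sub_eq_zero] at hz1
    rw [hz1]; exact one_ne_zero
  obtain ⟨Z, hZ⟩ := hzu
  have hGz : G.eval ((Z⁻¹ : Rˣ) : R) = 0 := by
    let : Invertible ((Z⁻¹ : Rˣ) : R) := (Z⁻¹).invertible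
    have := (eval₂_reverse_eq_zero_iff (RingHom.id R) ((Z⁻¹ : Rˣ) : R) G).1 (by
      rw [eval₂_id]
      have : (⅟((Z⁻¹ : Rˣ) : R)) = z := by
        rw [invOf_units]; simp [hZ]
      rw [this]; exact hz)
    rwa [eval₂_id] at this
  refine ⟨-(q0 * u) * ((Z⁻¹ : Rˣ) : R), ?_⟩
  set x := ((Z⁻¹ : Rˣ) : R)
  have : Q.eval (-(q0 * u) * x) = q0 * G.eval x := by
    rw [hQ, hG]
    simp only [eval_add, eval_mul, eval_sub, eval_one, eval_X, eval_pow, eval_C, eval_comp]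
    linear_combination (-(q0 * x)) * hu
  rw [IsRoot, this, hGz, mul_zero]

theorem ValuationSubring.exists_isRoot_of_coeff {K : Type*} [Field K] (O : ValuationSubring K)
    (hO : HenselianLocalRing O) (Q : K[X]) (h0 : ∀ i, O.valuation (Q.coeff i) ≤ 1)
    (h1 : O.valuation (Q.coeff 1 - 1) < 1) (h2 : ∀ i, 2 ≤ i → O.valuation (Q.coeff i) < 1) :
    ∃ z, Q.IsRoot z := by
  obtain ⟨P, rfl⟩ : ∃ P : O[X], P.map (algebraMap O K) = Q := by
    rw [← mem_lifts, lifts_iff_coeff_lifts]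
    exact fun n => ⟨⟨Q.coeff n, (O.valuation_le_one_iff _).1 (h0 n)⟩, rfl⟩
  simp only [coeff_map] at h1 h2
  obtain ⟨z, hz⟩ := HenselianLocalRing.exists_isRoot_of_coeff P (by
    rw [ValuationSubring.valuation_eq_one_iff]
    have := O.valuation.map_add_eq_of_lt_left (x := 1)
      (y := algebraMap O K (P.coeff 1) - 1) (by rwa [map_one])
    simpa using this)
    (fun i hi => (O.valuation_lt_one_iff _).2 (h2 i hi))
  exact ⟨algebraMap O K z, hz.map⟩

/-! ### Polynomials and rational functions near a limit over a henselian field -/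

section Valued

variable {K L Γ₀ : Type*} [Field K] [Field L] [Algebra K L] [LinearOrderedCommGroupWithZero Γ₀]

/-- A polynomial with small values at enough consecutive integers has small coefficients. -/
theorem Valuation.map_coeff_lt_of_eval_natCast (v : Valuation K Γ₀)
    (hn : ∀ n : ℕ, n ≠ 0 → v n = 1) {B : Γ₀} (hB : 0 < B) (n : ℕ) :
    ∀ (m : ℕ) (R : K[X]), R.degree < n → (∀ k, m ≤ k → k < m + n → v (R.eval (k : K)) < B) →
      ∀ i, v (R.coeff i) < B := by
  induction n with
  | zero =>
    intro m R hR _ i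
    have : R = 0 := by
      rw [← degree_eq_bot]
      exact Nat.WithBot.lt_zero_iff.1 hR
    simpa [this] using hB
  | succ n ih =>
    intro m R hR hk i
    have hnat : ∀ n : ℕ, v n ≤ 1 := fun n => by
      rcases eq_or_ne n 0 with rfl | h
      · simp
      · exact (hn n h).le
    -- For k > m, T(k) = (R(k) - R(m)) / (k - m), and k - m has value 1, so T is small at the n
    -- integers after m.
    obtain ⟨T, hT⟩ : X - C (m : K) ∣ R - C (R.eval (m : K)) := by
      rw [dvd_iff_isRoot]; simp
    have hRT : R = (X - C (m : K)) * T + C (R.eval (m : K)) := by rw [← hT]; ring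
    have hm := hk m le_rfl (by omega)
    have hTd : T.degree < n := by
      rcases eq_or_ne T 0 with rfl | hT0
      · simp
      have h1 : (R - C (R.eval (m : K))).degree < (n + 1 : ℕ) :=
        lt_of_le_of_lt (degree_sub_le _ _) (max_lt hR
          (lt_of_le_of_lt degree_C_le (by exact_mod_cast Nat.succ_pos n)))
      rw [hT, degree_mul, degree_X_sub_C, degree_eq_natDegree hT0] at h1
      rw [degree_eq_natDegree hT0]
      norm_cast at h1 ⊢
      omega
    have hTc := ih (m + 1) T hTd (fun k hk1 hk2 => by
      have h1 := hk k (by omega) (by omega)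
      have h2 : ((k - m : ℕ) : K) * T.eval (k : K) = R.eval (k : K) - R.eval (m : K) := by
        conv_rhs => rw [hRT]
        simp [Nat.cast_sub (show m ≤ k by omega)]
      have h3 := v.map_sub_lt h1 hm
      rwa [← h2, map_mul, hn _ (by omega), one_mul] at h3)
    rw [hRT, coeff_add]
    refine v.map_add_lt ?_ ?_
    · rw [sub_mul, coeff_sub, coeff_C_mul]
      refine v.map_sub_lt ?_ ?_
      · cases i with
        | zero => simpa using hB
        | succ i => rw [coeff_X_mul]; exact hTc i
      · rw [map_mul]
        exact lt_of_le_of_lt (mul_le_of_le_one_left' (hnat m)) (hTc i)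
    · rw [coeff_C]
      split_ifs
      · exact hm
      · simpa using hB

theorem Valuation.map_aeval_lt (v : Valuation K Γ₀) (w : Valuation L Γ₀)
    (hv : ∀ a, w (algebraMap K L a) = v a) {B : Γ₀} (hB : 0 < B) {R : K[X]} {u : L} (hu : w u ≤ 1)
    (hR : ∀ i, v (R.coeff i) < B) : w (aeval u R) < B := by
  rw [aeval_eq_sum_range]
  refine w.map_sum_lt hB.ne' fun i _ => ?_
  rw [Algebra.smul_def, map_mul, map_pow, hv]
  exact lt_of_le_of_lt (mul_le_of_le_one_right' (pow_le_one' hu i)) (hR i)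

/-- The filter on `K` of approximations to the element `y` of the valued extension `L`. -/
def approx (K : Type*) [Field K] [Algebra K L] (w : Valuation L Γ₀) (y : L) : Filter K :=
  ⨅ a₀ : K, 𝓟 {a | w (y - algebraMap K L a) ≤ w (y - algebraMap K L a₀)}

theorem eventually_approx {w : Valuation L Γ₀} {y : L} {p : K → Prop} :
    (∀ᶠ a in approx K w y, p a) ↔
      ∃ a₀, ∀ a, w (y - algebraMap K L a) ≤ w (y - algebraMap K L a₀) → p a := by
  have hd : Directed (· ≥ ·)
      fun a₀ : K => {a : K | w (y - algebraMap K L a) ≤ w (y - algebraMap K L a₀)} := by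
    intro a b
    rcases le_total (w (y - algebraMap K L a)) (w (y - algebraMap K L b)) with h | h
    · exact ⟨a, fun x hx => hx, fun x hx => le_trans hx h⟩
    · exact ⟨b, fun x hx => le_trans hx h, fun x hx => hx⟩
  rw [approx, (hasBasis_iInf_principal hd).eventually_iff]
  simp

instance approx_neBot (w : Valuation L Γ₀) (y : L) : (approx K w y).NeBot := by
  refine ⟨fun h => ?_⟩
  have : ∀ᶠ a in approx K w y, False := by rw [h]; exact eventually_bot
  obtain ⟨a, ha⟩ := eventually_approx.1 this
  exact ha a le_rfl

/-- If `p` holds eventually, it eventually holds also at all better approximations. -/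
theorem eventually_approx_forall {w : Valuation L Γ₀} {y : L} {p : K → Prop}
    (h : ∀ᶠ a in approx K w y, p a) :
    ∀ᶠ a in approx K w y, ∀ b, w (y - algebraMap K L b) ≤ w (y - algebraMap K L a) → p b := by
  obtain ⟨a₀, h⟩ := eventually_approx.1 h
  exact eventually_approx.2 ⟨a₀, fun a ha b hb => h b (hb.trans ha)⟩

/-- `y` is a limit of elements of the valued field `K` without best approximation in `K`, where
`K` is henselian of residue characteristic zero. -/
structure IsHenselianLimit (v : Valuation K Γ₀) (w : Valuation L Γ₀) (y : L) : Prop where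
  map_algebraMap : ∀ a, w (algebraMap K L a) = v a
  map_natCast : ∀ n : ℕ, n ≠ 0 → v n = 1
  exists_isRoot : ∀ Q : K[X], (∀ i, v (Q.coeff i) ≤ 1) → v (Q.coeff 1 - 1) < 1 →
    (∀ i, 2 ≤ i → v (Q.coeff i) < 1) → ∃ z, Q.IsRoot z
  exists_eq : ∀ a : K, ∃ c : K, w (y - algebraMap K L a) = v c
  exists_lt : ∀ a : K, ∃ b : K, w (y - algebraMap K L b) < w (y - algebraMap K L a)

namespace IsHenselianLimit

variable {v : Valuation K Γ₀} {w : Valuation L Γ₀} {y : L}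

theorem pos (h : IsHenselianLimit v w y) (a : K) : 0 < w (y - algebraMap K L a) := by
  obtain ⟨b, hb⟩ := h.exists_lt a
  exact lt_of_le_of_lt zero_le hb

theorem charZero (h : IsHenselianLimit v w y) : CharZero K :=
  charZero_of_inj_zero fun n hn => by
    by_contra h0
    have := h.map_natCast n h0
    rw [hn, map_zero] at this
    exact zero_ne_one this

theorem eventually_lt (h : IsHenselianLimit v w y) (b : K) :
    ∀ᶠ a in approx K w y, w (y - algebraMap K L a) < w (y - algebraMap K L b) := by
  obtain ⟨c, hc⟩ := h.exists_lt b
  exact eventually_approx.2 ⟨c, fun a ha => ha.trans_lt hc⟩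

theorem map_sub_natCast_mul_le (h : IsHenselianLimit v w y) {a t : K}
    (ht : w (y - algebraMap K L a) = v t) (k : ℕ) :
    w (y - algebraMap K L (a + t * k)) ≤ w (y - algebraMap K L a) := by
  have hk : v k ≤ 1 := by
    rcases eq_or_ne k 0 with rfl | h0
    · simp
    · exact (h.map_natCast k h0).le
  rw [map_add, ← sub_sub]
  refine w.map_sub_le le_rfl ?_
  rw [h.map_algebraMap, map_mul, ht]
  exact mul_le_of_le_one_right' hk

/-- If P′ is nearly constant on the ball around y through a, then P is nearly affine there. Failure
of P(y) ~ P(a) then means that P(a) is at most as large as the variation of P on this ball, so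
Hensel's lemma applies after rescaling. -/
theorem exists_isRoot_of_not_lt (h : IsHenselianLimit v w y) {P : K[X]} {a : K}
    (hd : ∀ b, w (y - algebraMap K L b) ≤ w (y - algebraMap K L a) →
      w (aeval y P.derivative - algebraMap K L (P.derivative.eval b)) < v (P.derivative.eval b))
    (ha : ¬ w (aeval y P - algebraMap K L (P.eval a)) < v (P.eval a)) : ∃ z, P.IsRoot z := by
  obtain ⟨t, ht⟩ := h.exists_eq a
  have ht0 : t ≠ 0 := by
    rintro rfl
    exact (h.pos a).ne' (by rw [ht, map_zero])
  have hB : ∀ b, w (y - algebraMap K L b) ≤ w (y - algebraMap K L a) →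
      w (aeval y P.derivative) = v (P.derivative.eval b) := fun b hb => by
    have := w.map_add_eq_of_lt_left (x := algebraMap K L (P.derivative.eval b))
      (y := aeval y P.derivative - algebraMap K L (P.derivative.eval b))
      (by rw [h.map_algebraMap]; exact hd b hb)
    rwa [add_sub_cancel, h.map_algebraMap] at this
  set d := P.derivative.eval a with hd0
  have hvd : 0 < v d := lt_of_le_of_lt zero_le (hd a le_rfl)
  have hdne : d ≠ 0 := fun hz => by simp [hz] at hvd
  set c := (t * d)⁻¹ with hc
  have hc0 : c ≠ 0 := inv_ne_zero (mul_ne_zero ht0 hdne)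
  -- The scaling makes Q′(x) = P′(a + t * x) / P′(a) and sends y to an element u of value 1. The
  -- points a + t * k with k a natural number lie in the ball where P′ is controlled, so Q′ - 1 is
  -- small at all of them, hence has small coefficients.
  set Q : K[X] := C c * P.comp (C a + C t * X) with hQ
  have hQd : ∀ x : K, (Q.derivative - 1).eval x
      = (P.derivative.eval (a + t * x) - d) * d⁻¹ := fun x => by
    simp [hQ, derivative_comp, hc]
    field_simp
  have hsmall : ∀ i, v ((Q.derivative - 1).coeff i) < 1 := by
    refine v.map_coeff_lt_of_eval_natCast h.map_natCast one_pos
      ((Q.derivative - 1).natDegree + 1) 0 _ ?_ fun k _ _ => ?_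
    · exact degree_le_natDegree.trans_lt (by exact_mod_cast Nat.lt_succ_self _)
    · have hk := h.map_sub_natCast_mul_le ht k
      have h1 := hd _ hk
      have h2 := hd _ le_rfl
      rw [← hB _ hk] at h1
      rw [← hB _ le_rfl] at h2
      have h3 := w.map_sub_lt h2 h1
      rw [sub_sub_sub_cancel_left, ← map_sub, h.map_algebraMap, hB a le_rfl] at h3
      rw [hQd, map_mul, map_inv₀]
      exact (mul_inv_lt_iff₀ hvd).2 (by rwa [one_mul])
  have hQ1 : v (Q.coeff 1 - 1) < 1 := by
    have := hsmall 0
    simpa [coeff_derivative] using this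
  have hQ2 : ∀ i, 2 ≤ i → v (Q.coeff i) < 1 := fun i hi => by
    obtain ⟨j, rfl⟩ : ∃ j, i = j + 1 := ⟨i - 1, by omega⟩
    have := hsmall j
    rw [coeff_sub, coeff_derivative, coeff_one, if_neg (by omega), sub_zero, map_mul] at this
    have h1 := h.map_natCast (j + 1) (by omega)
    push_cast at h1
    rwa [h1, mul_one] at this
  set u : L := (y - algebraMap K L a) / algebraMap K L t with hu
  have htL : algebraMap K L t ≠ 0 := by simpa using ht0
  have hwu : w u = 1 := by
    rw [hu, map_div₀, h.map_algebraMap, ht, div_self (by simpa using ht0)]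
  have hQu : aeval u Q = algebraMap K L c * aeval y P := by
    rw [hQ, map_mul, aeval_C, aeval_comp]
    congr 2
    simp only [map_add, map_mul, aeval_C, aeval_X, hu, mul_div_cancel₀ _ htL, add_sub_cancel]
  have hQ0 : Q.coeff 0 = c * P.eval a := by
    rw [coeff_zero_eq_eval_zero, hQ]; simp
  have hR : w (aeval u (Q - C (Q.coeff 0) - X)) < 1 := by
    refine Valuation.map_aeval_lt v w h.map_algebraMap one_pos hwu.le fun i => ?_
    match i with
    | 0 => simp
    | 1 => simpa using hQ1
    | i + 2 => simpa [coeff_X, coeff_C] using hQ2 (i + 2) (by omega)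
  -- Here Q(u) - Q(0) equals u up to a smaller error, so it has value 1; thus `ha` bounds the
  -- constant coefficient of Q by 1.
  have hdiff : w (algebraMap K L c * (aeval y P - algebraMap K L (P.eval a))) = 1 := by
    have h1 := w.map_add_eq_of_lt_left (x := u)
      (y := aeval u (Q - C (Q.coeff 0) - X)) (by rwa [hwu])
    rw [hwu] at h1
    rw [← h1, map_sub (aeval (R := K) u), map_sub (aeval (R := K) u), hQu, aeval_C, hQ0, aeval_X,
      map_mul (algebraMap K L)]
    congr 1
    ring
  have hQ0' : v (Q.coeff 0) ≤ 1 := by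
    rw [hQ0, map_mul, ← hdiff, map_mul, h.map_algebraMap]
    gcongr
    exact not_lt.1 ha
  obtain ⟨z, hz⟩ := h.exists_isRoot Q (fun i => by
    match i with
    | 0 => exact hQ0'
    | 1 =>
      have := v.map_add_le (g := 1) hQ1.le (map_one v).le
      simpa using this
    | i + 2 => exact (hQ2 _ (by omega)).le) hQ1 hQ2
  refine ⟨a + t * z, ?_⟩
  rw [IsRoot, hQ, eval_mul, eval_C, eval_comp] at hz
  simpa [hc0] using hz

/-- Nonzero polynomial functions are asymptotically constant near `y`. -/
theorem eventually_map_aeval_sub_lt (h : IsHenselianLimit v w y) (P : K[X]) (hP : P ≠ 0) :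
    ∀ᶠ a in approx K w y, w (aeval y P - algebraMap K L (P.eval a)) < v (P.eval a) := by
  have := h.charZero
  induction hn : P.natDegree using Nat.strong_induction_on generalizing P with
  | _ n ih =>
    subst hn
    rcases Nat.eq_zero_or_pos P.natDegree with h0 | h0
    · obtain ⟨c, rfl⟩ := natDegree_eq_zero.1 h0
      refine Eventually.of_forall fun a => ?_
      simpa [zero_lt_iff] using hP
    -- Otherwise the estimate fails at approximations arbitrarily close to y, in particular where P′
    -- is already nearly constant. This yields a root z of P in K, and the estimate for P follows
    -- from those for X - z and P / (X - z).
    by_contra hcon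
    have hd := ih _ (natDegree_derivative_lt h0.ne') P.derivative
      (fun hz => h0.ne' (derivative_eq_zero.1 hz)) rfl
    obtain ⟨a, ha, hda⟩ := ((not_eventually.1 hcon).and_eventually
      (eventually_approx_forall hd)).exists
    obtain ⟨z, hz⟩ := h.exists_isRoot_of_not_lt hda ha
    obtain ⟨T, rfl⟩ := dvd_iff_isRoot.2 hz
    have hT : T ≠ 0 := right_ne_zero_of_mul hP
    refine hcon ?_
    filter_upwards [h.eventually_lt z, ih _ (by
      rw [natDegree_mul (X_sub_C_ne_zero z) hT, natDegree_X_sub_C]; omega) T hT rfl] with b hb hTb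
    have h1 : w (y - algebraMap K L z) = v (b - z) := by
      have := w.map_sub_eq_of_lt_left hb
      rw [← h.map_algebraMap, ← this, (algebraMap K L).map_sub, sub_sub_sub_cancel_left]
    rw [h1] at hb
    have h2 : w (aeval y T) = v (T.eval b) := by
      have := w.map_add_eq_of_lt_left (x := algebraMap K L (T.eval b))
        (y := aeval y T - algebraMap K L (T.eval b)) (by rwa [h.map_algebraMap])
      rwa [add_sub_cancel, h.map_algebraMap] at this
    have h3 : aeval y ((X - C z) * T) - algebraMap K L (((X - C z) * T).eval b)
        = (y - algebraMap K L b) * aeval y T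
          + algebraMap K L (b - z) * (aeval y T - algebraMap K L (T.eval b)) := by
      simp; ring
    have hTpos : 0 < v (T.eval b) := lt_of_le_of_lt zero_le hTb
    have hbpos : 0 < v (b - z) := lt_of_le_of_lt zero_le hb
    rw [h3, eval_mul, map_mul]
    refine w.map_add_lt ?_ ?_
    · rw [map_mul, h2]
      simpa using mul_lt_mul_of_pos_right hb hTpos
    · rw [map_mul, h.map_algebraMap]
      simpa using mul_lt_mul_of_pos_left hTb hbpos

theorem eventually_map_aeval_eq (h : IsHenselianLimit v w y) (P : K[X]) (hP : P ≠ 0) :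
    ∀ᶠ a in approx K w y, w (aeval y P) = v (P.eval a) := by
  filter_upwards [h.eventually_map_aeval_sub_lt P hP] with a ha
  have := w.map_add_eq_of_lt_left (x := algebraMap K L (P.eval a))
    (y := aeval y P - algebraMap K L (P.eval a)) (by rwa [h.map_algebraMap])
  rwa [add_sub_cancel, h.map_algebraMap] at this

theorem aeval_ne_zero (h : IsHenselianLimit v w y) {P : K[X]} (hP : P ≠ 0) : aeval y P ≠ 0 := by
  obtain ⟨a, ha, hb⟩ :=
    ((h.eventually_map_aeval_sub_lt P hP).and (h.eventually_map_aeval_eq P hP)).exists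
  intro h0
  rw [h0, map_zero] at hb
  rw [← hb] at ha
  exact not_lt_zero ha

/-- Nonzero rational functions are asymptotically constant near `y`. -/
theorem eventually_map_div_sub_lt (h : IsHenselianLimit v w y) {P Q : K[X]} (hP : P ≠ 0)
    (hQ : Q ≠ 0) : ∀ᶠ a in approx K w y,
      w (aeval y P / aeval y Q - algebraMap K L (P.eval a / Q.eval a))
        < w (aeval y P / aeval y Q) := by
  filter_upwards [h.eventually_map_aeval_sub_lt P hP, h.eventually_map_aeval_sub_lt Q hQ,
    h.eventually_map_aeval_eq P hP, h.eventually_map_aeval_eq Q hQ] with a h1 h2 h3 h4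
  have hQ0 := h.aeval_ne_zero hQ
  have hP0 := h.aeval_ne_zero hP
  have hQpos : 0 < w (aeval y Q) := zero_lt_iff.2 (by simpa using hQ0)
  have hPpos : 0 < w (aeval y P) := zero_lt_iff.2 (by simpa using hP0)
  have hQa : algebraMap K L (Q.eval a) ≠ 0 := by
    rw [← w.ne_zero_iff, h.map_algebraMap, ← h4]; exact hQpos.ne'
  have key : aeval y P / aeval y Q - algebraMap K L (P.eval a / Q.eval a)
      = ((aeval y P - algebraMap K L (P.eval a)) * algebraMap K L (Q.eval a)
          - algebraMap K L (P.eval a) * (aeval y Q - algebraMap K L (Q.eval a)))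
        / (aeval y Q * algebraMap K L (Q.eval a)) := by
    rw [map_div₀]; field_simp; ring
  rw [key, map_div₀, map_div₀, map_mul, h.map_algebraMap, ← h4,
    div_lt_div_iff₀ (mul_pos hQpos hQpos) hQpos, ← mul_assoc]
  refine mul_lt_mul_of_pos_right ?_ hQpos
  refine w.map_sub_lt ?_ ?_
  · rw [map_mul, h.map_algebraMap, ← h4]
    exact mul_lt_mul_of_pos_right (by rwa [h3]) hQpos
  · rw [map_mul, h.map_algebraMap, ← h3]
    exact mul_lt_mul_of_pos_left (by rwa [h4]) hPpos

end IsHenselianLimit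

end Valued

/-! ### Asymptotic differential fields with multiplicatively written valuations -/

section DifferentialField

variable {L : Type*} [Field L] [Differential L]

theorem Differential.logDeriv_inv' (f : L) : logDeriv f⁻¹ = -logDeriv f := by
  rcases eq_or_ne f 0 with rfl | hf
  · simp
  · simpa using logDeriv_div (1 : L) f one_ne_zero hf

theorem Differential.logDeriv_mul_self {f : L} (hf : f ≠ 0) : logDeriv f * f = f′ := by
  rw [logDeriv, div_mul_cancel₀ _ hf]

variable {Γ₀ : Type*} [LinearOrderedCommGroupWithZero Γ₀]

/-- A valuation, written multiplicatively, turning the differential field `L` into an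
`H`-asymptotic field. -/
structure Valuation.IsHAsymptotic (w : Valuation L Γ₀) : Prop where
  lt_iff : ∀ f g : L, f ≠ 0 → g ≠ 0 → w f < 1 → w g < 1 → (w f < w g ↔ w f′ < w g′)
  map_logDeriv_le : ∀ f g : L, f ≠ 0 → w f ≤ w g → w g < 1 → w (logDeriv g) ≤ w (logDeriv f)

namespace Valuation.IsHAsymptotic

variable {w : Valuation L Γ₀}

theorem map_logDeriv_inv (f : L) : w (logDeriv f⁻¹) = w (logDeriv f) := by
  rw [Differential.logDeriv_inv', map_neg]

/-- A statement about `w (logDeriv g)` only has to be shown for `w g < 1`. -/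
theorem map_logDeriv_induction (p : Γ₀ → Prop)
    (h : ∀ g : L, g ≠ 0 → w g < 1 → p (w (logDeriv g))) {g : L} (hg : g ≠ 0) (hg1 : w g ≠ 1) :
    p (w (logDeriv g)) := by
  rcases lt_or_gt_of_ne hg1 with h1 | h1
  · exact h g hg h1
  · rw [← map_logDeriv_inv]
    refine h _ (inv_ne_zero hg) ?_
    rw [map_inv₀]
    exact inv_lt_one_of_one_lt₀ h1

theorem map_deriv (w : Valuation L Γ₀) {f : L} (hf : f ≠ 0) : w f′ = w (logDeriv f) * w f := by
  rw [← map_mul, Differential.logDeriv_mul_self hf]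

theorem map_logDeriv_pos (h : w.IsHAsymptotic) {g : L} (hg : g ≠ 0) (hg1 : w g ≠ 1) :
    0 < w (logDeriv g) := by
  refine map_logDeriv_induction (0 < ·) (fun g hg hg1 => ?_) hg hg1
  have hpos : 0 < w g := zero_lt_iff.2 (by simpa using hg)
  have h2 : w (g * g) < w g := by
    rw [map_mul]
    simpa using mul_lt_mul_of_pos_right hg1 hpos
  have h3 := (h.lt_iff _ _ (mul_ne_zero hg hg) hg (h2.trans hg1) hg1).1 h2
  have h4 : 0 < w g′ := lt_of_le_of_lt zero_le h3
  rw [map_deriv w hg] at h4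
  exact zero_lt_iff.2 (left_ne_zero_of_mul h4.ne')

theorem map_deriv_pos (h : w.IsHAsymptotic) {g : L} (hg : g ≠ 0) (hg1 : w g ≠ 1) :
    0 < w g′ := by
  rw [map_deriv w hg]
  exact mul_pos (h.map_logDeriv_pos hg hg1) (zero_lt_iff.2 (by simpa using hg))

/-- For g ≺ 1, both (f * g)′ and f * g′ are ≺ g′, hence so is their difference f′ * g; then divide
by g. -/
theorem map_deriv_lt_map_logDeriv (h : w.IsHAsymptotic) {f g : L} (hf : w f < 1) (hg : g ≠ 0)
    (hg1 : w g ≠ 1) : w f′ < w (logDeriv g) := by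
  refine map_logDeriv_induction (w f′ < ·) (fun g hg hg1 => ?_) hg hg1
  rcases eq_or_ne f 0 with rfl | hf0
  · simpa using h.map_logDeriv_pos hg hg1.ne
  have hpos : 0 < w g := zero_lt_iff.2 (by simpa using hg)
  have h2 : w (f * g) < w g := by
    rw [map_mul]
    simpa using mul_lt_mul_of_pos_right hf hpos
  have h3 := (h.lt_iff _ _ (mul_ne_zero hf0 hg) hg (h2.trans hg1) hg1).1 h2
  have h4 : w (f * g′) < w g′ := by
    rw [map_mul]
    simpa using mul_lt_mul_of_pos_right hf (h.map_deriv_pos hg hg1.ne)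
  have h5 := w.map_sub_lt h3 h4
  rw [Derivation.leibniz, smul_eq_mul, smul_eq_mul, add_sub_cancel_left, map_mul,
    map_deriv w hg, mul_comm] at h5
  exact lt_of_mul_lt_mul_right h5 zero_le

theorem map_deriv_lt_map_deriv (h : w.IsHAsymptotic) {f g : L} (hg1 : w g ≠ 1)
    (hfg : w f < w g) : w f′ < w g′ := by
  have hpos : 0 < w g := lt_of_le_of_lt zero_le hfg
  have hg : g ≠ 0 := by rintro rfl; simp at hpos
  have hq : w (f / g) < 1 := by
    rw [map_div₀]
    exact (div_lt_one₀ hpos).2 hfg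
  have h1 : f′ = (f / g) * g′ + g * (f / g)′ := by
    conv_lhs => rw [← div_mul_cancel₀ f hg]
    rw [Derivation.leibniz, smul_eq_mul, smul_eq_mul]
  rw [h1]
  refine w.map_add_lt ?_ ?_
  · rw [map_mul]
    simpa using mul_lt_mul_of_pos_right hq (h.map_deriv_pos hg hg1)
  · rw [map_mul, map_deriv w hg, mul_comm]
    exact mul_lt_mul_of_pos_right (h.map_deriv_lt_map_logDeriv hq hg hg1) hpos

theorem map_logDeriv_le_of_one_lt (h : w.IsHAsymptotic) {f g : L} (hg : 1 < w g)
    (hfg : w g ≤ w f) : w (logDeriv g) ≤ w (logDeriv f) := by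
  have hf : 0 < w f := (zero_lt_one.trans hg).trans_le hfg
  rw [← map_logDeriv_inv g, ← map_logDeriv_inv f]
  refine h.map_logDeriv_le _ _ (inv_ne_zero (by rintro rfl; simp at hf)) ?_ ?_
  · rw [map_inv₀, map_inv₀]
    exact inv_anti₀ (zero_lt_one.trans hg) hfg
  · rw [map_inv₀]
    exact inv_lt_one_of_one_lt₀ hg

theorem comap {K : Type*} [Field K] [Differential K] [Algebra K L] [DifferentialAlgebra K L]
    (h : w.IsHAsymptotic) {v : Valuation K Γ₀} (hv : ∀ a, w (algebraMap K L a) = v a) :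
    v.IsHAsymptotic where
  lt_iff f g hf hg hf1 hg1 := by
    have := h.lt_iff (algebraMap K L f) (algebraMap K L g) (by simpa) (by simpa)
      (by rwa [hv]) (by rwa [hv])
    simpa only [deriv_algebraMap, hv] using this
  map_logDeriv_le f g hf hfg hg := by
    have := h.map_logDeriv_le (algebraMap K L f) (algebraMap K L g) (by simpa)
      (by rwa [hv, hv]) (by rwa [hv])
    simpa only [Differential.logDeriv_algebraMap, hv] using this

end Valuation.IsHAsymptotic

end DifferentialField

/-! ### Approximating a large integral -/

/-- `y` is an integral of `s`, in an `H`-asymptotic extension of `K`, such that all values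
`v (s - a′)` are derivatives of elements of `Γ^<`, and `K` is pre-`d`-valued. -/
structure IsLargeIntegral {K L Γ₀ : Type*} [Field K] [Differential K] [Field L] [Differential L]
    [Algebra K L] [LinearOrderedCommGroupWithZero Γ₀] (v : Valuation K Γ₀) (w : Valuation L Γ₀)
    (s : K) (y : L) : Prop where
  hAsymptotic : w.IsHAsymptotic
  map_algebraMap : ∀ a, w (algebraMap K L a) = v a
  preDValued : ∀ f g : K, f ≠ 0 → g ≠ 0 → v f ≤ 1 → v g < 1 → v f′ < v (logDeriv g)
  deriv_eq : y′ = algebraMap K L s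
  exists_deriv : ∀ a : K, ∃ b : K, 1 < v b ∧ v (s - a′) = v b′

namespace IsLargeIntegral

variable {K L Γ₀ : Type*} [Field K] [Differential K] [Field L] [Differential L]
  [Algebra K L] [DifferentialAlgebra K L] [LinearOrderedCommGroupWithZero Γ₀]
  {v : Valuation K Γ₀} {w : Valuation L Γ₀} {s : K} {y : L}

/-- The derivation is strictly monotone when the larger element is ≭ 1. Since b ≻ 1, the larger of y
- a and b is always ≻ 1, so derivatives of equal size force equal size. -/
theorem map_sub_eq (h : IsLargeIntegral v w s y) {a b : K} (hb : 1 < v b)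
    (hab : v (s - a′) = v b′) : w (y - algebraMap K L a) = v b := by
  have hH := h.hAsymptotic
  set z := y - algebraMap K L a with hz
  set bL := algebraMap K L b with hbL
  have hb1 : 1 < w bL := by rwa [h.map_algebraMap]
  have hb0 : bL ≠ 0 := by rintro h0; rw [h0, map_zero] at hb1; exact not_lt_zero hb1
  have hzd : w z′ = w bL′ := by
    rw [hz, hbL, map_sub, h.deriv_eq, deriv_algebraMap, deriv_algebraMap, ← map_sub,
      h.map_algebraMap, h.map_algebraMap, hab]
  rw [← h.map_algebraMap]
  rcases lt_trichotomy (w z) (w bL) with hlt | heq | hgt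
  · exact absurd hzd (hH.map_deriv_lt_map_deriv hb1.ne' hlt).ne
  · exact heq
  · exact absurd hzd (hH.map_deriv_lt_map_deriv (hb1.trans hgt).ne' hgt).ne'

theorem exists_map_sub_eq (h : IsLargeIntegral v w s y) (a : K) :
    ∃ b, 1 < v b ∧ v (s - a′) = v b′ ∧ w (y - algebraMap K L a) = v b := by
  obtain ⟨b, hb, hab⟩ := h.exists_deriv a
  exact ⟨b, hb, hab, h.map_sub_eq hb hab⟩

/-- Every approximation to `y` can be improved by a definite amount. -/
theorem exists_better (h : IsLargeIntegral v w s y) (a : K) :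
    ∃ a₁ b₁, 1 < v b₁ ∧ w (y - algebraMap K L a₁) = v b₁ ∧
      ∀ g, g ≠ 0 → v g ≠ 1 →
        v b₁ * v (logDeriv b₁) < w (y - algebraMap K L a) * v (logDeriv g) := by
  have hK := h.hAsymptotic.comap h.map_algebraMap
  obtain ⟨b, hb, hab, hyb⟩ := h.exists_map_sub_eq a
  have hvb : 0 < v b := zero_lt_one.trans hb
  have hb0 : b ≠ 0 := by rintro rfl; simp at hvb
  have hbd : 0 < v b′ := hK.map_deriv_pos hb0 hb.ne'
  have hbd0 : b′ ≠ 0 := by intro h0; simp [h0] at hbd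
  set u := (s - a′) / b′ with hu
  have hvu : v u = 1 := by rw [hu, map_div₀, hab, div_self hbd.ne']
  have hu0 : u ≠ 0 := by rintro h0; simp [h0] at hvu
  -- The multiple u * b cancels the leading part of s - a′ and leaves only -(u′ * b), where u′ ≺ g†
  -- because u ≼ 1.
  obtain ⟨b₁, hb₁, hab₁, hyb₁⟩ := h.exists_map_sub_eq (a + u * b)
  refine ⟨a + u * b, b₁, hb₁, hyb₁, fun g hg hg1 => ?_⟩
  have hb₁0 : b₁ ≠ 0 := by
    rintro rfl
    rw [map_zero] at hb₁
    exact not_lt_zero hb₁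
  have h1 : s - (a + u * b)′ = -(u′ * b) := by
    rw [map_add, Derivation.leibniz, smul_eq_mul, smul_eq_mul]
    have : u * b′ = s - a′ := div_mul_cancel₀ _ hbd0
    linear_combination -this
  rw [hyb, mul_comm (v b₁), ← Valuation.IsHAsymptotic.map_deriv v hb₁0, ← hab₁, h1,
    Valuation.map_neg, map_mul, mul_comm]
  refine mul_lt_mul_of_pos_left ?_ hvb
  exact Valuation.IsHAsymptotic.map_logDeriv_induction (w := v) (v u′ < ·)
    (fun g hg hg1 => h.preDValued u g hu0 hg hvu.le hg1) hg hg1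

theorem exists_map_sub_lt (h : IsLargeIntegral v w s y) (a : K) :
    ∃ a₁, w (y - algebraMap K L a₁) < w (y - algebraMap K L a) := by
  have hK := h.hAsymptotic.comap h.map_algebraMap
  obtain ⟨a₁, b₁, hb₁, hyb₁, hg⟩ := h.exists_better a
  refine ⟨a₁, ?_⟩
  have hb₁0 : b₁ ≠ 0 := by
    rintro rfl
    rw [map_zero] at hb₁
    exact not_lt_zero hb₁
  rw [hyb₁]
  exact lt_of_mul_lt_mul_right (hg b₁ hb₁0 hb₁.ne') zero_le

theorem one_lt (h : IsLargeIntegral v w s y) (a : K) : 1 < w (y - algebraMap K L a) := by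
  obtain ⟨b, hb, -, hyb⟩ := h.exists_map_sub_eq a
  rwa [hyb]

end IsLargeIntegral

/-! ### Variation of a rational function near `y` -/

section Growth

variable {K L Γ₀ : Type*} [Field K] [Field L] [Algebra K L] [LinearOrderedCommGroupWithZero Γ₀]

/-- The numerators of the Taylor coefficients of `P / Q` at `a`, up to the factor `Q (a)`. -/
noncomputable def crossDeriv (P Q : K[X]) (k : ℕ) : K[X] :=
  hasseDeriv k P * Q - P * hasseDeriv k Q

/-- The polynomial in `x` describing `P (a + x) / Q (a + x) - P (a) / Q (a)`. -/
noncomputable def crossTaylor (P Q : K[X]) (a : K) : K[X] :=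
  taylor a P * C (Q.eval a) - C (P.eval a) * taylor a Q

theorem coeff_crossTaylor (P Q : K[X]) (a : K) (k : ℕ) :
    (crossTaylor P Q a).coeff k = (crossDeriv P Q k).eval a := by
  simp [crossTaylor, crossDeriv, taylor_coeff]

theorem natDegree_crossTaylor_le (P Q : K[X]) (a : K) :
    (crossTaylor P Q a).natDegree ≤ max P.natDegree Q.natDegree := by
  refine (natDegree_sub_le _ _).trans (max_le_max ?_ ?_)
  · exact (natDegree_mul_C_le _ _).trans (natDegree_taylor _ _).le
  · exact (natDegree_C_mul_le _ _).trans (natDegree_taylor _ _).le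

theorem aeval_sub_crossTaylor (P Q : K[X]) (a : K) (z : L) :
    aeval (z - algebraMap K L a) (crossTaylor P Q a)
      = aeval z P * algebraMap K L (Q.eval a) - algebraMap K L (P.eval a) * aeval z Q := by
  have ht : ∀ T : K[X], aeval (z - algebraMap K L a) (taylor a T) = aeval z T := fun T => by
    rw [taylor_apply, aeval_comp]
    simp
  simp [crossTaylor, ht]

theorem eval_crossTaylor (P Q : K[X]) (a x : K) :
    (crossTaylor P Q a).eval x
      = P.eval (a + x) * Q.eval a - P.eval a * Q.eval (a + x) := by
  simp [crossTaylor, taylor_eval, add_comm]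

/-- The order of magnitude of `P / Q` near `y` at distance `r`, up to a constant factor. -/
noncomputable def growth (w : Valuation L Γ₀) (y : L) (P Q : K[X]) (r : Γ₀) : Γ₀ :=
  (Finset.range (max P.natDegree Q.natDegree + 1)).sup
    fun k => w (aeval y (crossDeriv P Q k)) * r ^ k

variable {v : Valuation K Γ₀} {w : Valuation L Γ₀} {y : L} {P Q : K[X]}

/-- The term k = 0 vanishes, so the growth divided by r is nondecreasing in r. -/
theorem growth_mul_le {r₁ r : Γ₀} (hr : r₁ ≤ r) :
    growth w y P Q r₁ * r ≤ growth w y P Q r * r₁ := by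
  obtain ⟨k, hk, he⟩ := Finset.exists_mem_eq_sup
    (Finset.range (max P.natDegree Q.natDegree + 1)) ⟨0, by simp⟩
    fun k => w (aeval y (crossDeriv P Q k)) * r₁ ^ k
  have h1 := Finset.le_sup (f := fun k => w (aeval y (crossDeriv P Q k)) * r ^ k) hk
  rw [growth, he]
  refine le_trans ?_ (mul_le_mul_left h1 r₁)
  cases k with
  | zero => simp [crossDeriv, mul_comm]
  | succ k =>
    rw [mul_assoc, mul_assoc]
    refine mul_le_mul_right ?_ _
    calc r₁ ^ (k + 1) * r = r₁ ^ k * (r * r₁) := by rw [pow_succ, mul_assoc, mul_comm r₁]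
      _ ≤ r ^ k * (r * r₁) := mul_le_mul_left (pow_le_pow_left₀ zero_le hr k) _
      _ = r ^ (k + 1) * r₁ := by rw [pow_succ, mul_assoc]

theorem growth_mono {r₁ r : Γ₀} (hr : r₁ ≤ r) : growth w y P Q r₁ ≤ growth w y P Q r := by
  refine Finset.sup_mono_fun fun k _ => ?_
  exact mul_le_mul_right (pow_le_pow_left₀ zero_le hr k) _

theorem growth_le_mul_pow {r : Γ₀} (hr : 1 ≤ r) :
    growth w y P Q r ≤ growth w y P Q 1 * r ^ max P.natDegree Q.natDegree := by
  refine Finset.sup_le fun k hk => ?_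
  have h1 := Finset.le_sup (f := fun k => w (aeval y (crossDeriv P Q k)) * 1 ^ k) hk
  simp only [one_pow, mul_one] at h1
  have h2 : r ^ k ≤ r ^ max P.natDegree Q.natDegree :=
    pow_le_pow_right₀ hr (by rw [Finset.mem_range] at hk; omega)
  refine mul_le_mul' ?_ h2
  simpa [growth] using h1

theorem exists_growth_one_eq (w : Valuation L Γ₀) (y : L) (P Q : K[X]) :
    ∃ k, growth w y P Q 1 = w (aeval y (crossDeriv P Q k)) := by
  obtain ⟨k, -, he⟩ := Finset.exists_mem_eq_sup
    (Finset.range (max P.natDegree Q.natDegree + 1)) ⟨0, by simp⟩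
    fun k => w (aeval y (crossDeriv P Q k)) * 1 ^ k
  exact ⟨k, by rw [growth, he]; simp⟩

namespace IsHenselianLimit

theorem eventually_map_aeval_eq' (h : IsHenselianLimit v w y) (T : K[X]) :
    ∀ᶠ a in approx K w y, w (aeval y T) = v (T.eval a) := by
  rcases eq_or_ne T 0 with rfl | hT
  · simp
  · exact h.eventually_map_aeval_eq T hT

theorem eventually_crossDeriv (h : IsHenselianLimit v w y) (P Q : K[X]) :
    ∀ᶠ a in approx K w y, ∀ k ∈ Finset.range (max P.natDegree Q.natDegree + 1),
      w (aeval y (crossDeriv P Q k)) = v ((crossDeriv P Q k).eval a) :=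
  (Filter.eventually_all_finset _).2 fun _ _ => h.eventually_map_aeval_eq' _

theorem eval_ne_zero (h : IsHenselianLimit v w y) (hQ : Q ≠ 0) {a : K}
    (ha : w (aeval y Q) = v (Q.eval a)) : Q.eval a ≠ 0 := by
  intro h0
  rw [h0, map_zero] at ha
  exact h.aeval_ne_zero hQ (by simpa using ha)

/-- Near y, Q(a) has the size of Q(y), and the Taylor numerators at a have the size of those at y.
The bound is then the ultrametric inequality for the expansion at a. -/
theorem eventually_le_growth (h : IsHenselianLimit v w y) (P : K[X]) (hQ : Q ≠ 0) :
    ∀ᶠ a in approx K w y,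
      w (aeval y P / aeval y Q - algebraMap K L (P.eval a / Q.eval a)) * w (aeval y Q) ^ 2
        ≤ growth w y P Q (w (y - algebraMap K L a)) := by
  filter_upwards [h.eventually_map_aeval_eq Q hQ, h.eventually_crossDeriv P Q] with a h1 h2
  have hQy := h.aeval_ne_zero hQ
  have hQa : algebraMap K L (Q.eval a) ≠ 0 := by simpa using h.eval_ne_zero hQ h1
  have h3 := aeval_sub_crossTaylor P Q a y
  have h4 : aeval y P / aeval y Q - algebraMap K L (P.eval a / Q.eval a)
      = aeval (y - algebraMap K L a) (crossTaylor P Q a)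
        / (aeval y Q * algebraMap K L (Q.eval a)) := by
    rw [h3, map_div₀]; field_simp
  have h5 : w (aeval y Q) ^ 2 ≠ 0 := pow_ne_zero _ (by simpa using hQy)
  rw [h4, map_div₀, map_mul, h.map_algebraMap, ← h1, ← pow_two, div_mul_cancel₀ _ h5,
    aeval_eq_sum_range' (Nat.lt_succ_of_le (natDegree_crossTaylor_le P Q a))]
  refine w.map_sum_le fun k hk => ?_
  rw [Algebra.smul_def, map_mul, map_pow, h.map_algebraMap, coeff_crossTaylor, ← h2 k hk]
  exact Finset.le_sup (f := fun k => w (aeval y (crossDeriv P Q k)) * _ ^ k) hk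

/-- Conversely, the upper bound is attained somewhere in the ball. With t ≍ y - a, if the variation
were too small at all a + t * k, k a natural number, then all coefficients of the rescaled Taylor
polynomial would be below the growth, yet one of them equals it in size. -/
theorem eventually_exists_growth_le (h : IsHenselianLimit v w y) (P : K[X]) (hQ : Q ≠ 0) :
    ∀ᶠ a in approx K w y, ∃ x, w (y - algebraMap K L x) ≤ w (y - algebraMap K L a) ∧
      growth w y P Q (w (y - algebraMap K L a)) ≤
        w (aeval y P / aeval y Q - algebraMap K L (P.eval x / Q.eval x)) * w (aeval y Q) ^ 2 := by
  filter_upwards [eventually_approx_forall (h.eventually_map_aeval_eq Q hQ),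
    h.eventually_crossDeriv P Q] with a h1 h2
  by_contra! hcon
  have hQy : w (aeval y Q) ≠ 0 := by simpa using h.aeval_ne_zero hQ
  obtain ⟨t, ht⟩ := h.exists_eq a
  set B := growth w y P Q (w (y - algebraMap K L a)) with hB
  have hB0 : 0 < B := lt_of_le_of_lt zero_le (hcon a le_rfl)
  have hsmall : ∀ i, v (((crossTaylor P Q a).comp (C t * X)).coeff i) < B := by
    refine v.map_coeff_lt_of_eval_natCast h.map_natCast hB0
      (((crossTaylor P Q a).comp (C t * X)).natDegree + 1) 0 _
      (degree_le_natDegree.trans_lt (by exact_mod_cast Nat.lt_succ_self _)) fun k _ _ => ?_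
    have hk := h.map_sub_natCast_mul_le ht k
    have hQa := h.eval_ne_zero hQ (h1 a le_rfl)
    have hQk := h.eval_ne_zero hQ (h1 _ hk)
    have h3 : ((crossTaylor P Q a).comp (C t * X)).eval (k : K)
        = (P.eval (a + t * k) / Q.eval (a + t * k) - P.eval a / Q.eval a)
          * (Q.eval (a + t * k) * Q.eval a) := by
      rw [eval_comp, eval_crossTaylor]
      simp only [eval_mul, eval_C, eval_X]
      field_simp
    have h4 := hcon a le_rfl
    have h5 := hcon _ hk
    rw [← map_pow, ← map_mul] at h4 h5
    have h6 := w.map_sub_lt h4 h5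
    rw [← sub_mul, sub_sub_sub_cancel_left, ← map_sub, map_mul, map_pow, h.map_algebraMap] at h6
    rwa [h3, map_mul, map_mul, ← h1 a le_rfl, ← h1 _ hk, ← pow_two]
  obtain ⟨k, hk, he⟩ := Finset.exists_mem_eq_sup
    (Finset.range (max P.natDegree Q.natDegree + 1)) ⟨0, by simp⟩
    fun k => w (aeval y (crossDeriv P Q k)) * w (y - algebraMap K L a) ^ k
  have h7 := hsmall k
  rw [comp_C_mul_X_coeff, map_mul, map_pow, coeff_crossTaylor, ← h2 k hk, ← ht] at h7
  exact h7.ne (by rw [hB, growth, he])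

/-- No element of `K` is closer to `P (y) / Q (y)` than all of its approximations
`P (a) / Q (a)`. -/
theorem eventually_map_div_sub_algebraMap_lt (h : IsHenselianLimit v w y) (P : K[X]) (hQ : Q ≠ 0) {c : K}
    (hc : aeval y P / aeval y Q ≠ algebraMap K L c) :
    ∀ᶠ a in approx K w y,
      w (aeval y P / aeval y Q - algebraMap K L (P.eval a / Q.eval a))
        < w (aeval y P / aeval y Q - algebraMap K L c) := by
  have hQy := h.aeval_ne_zero hQ
  have h1 : aeval y P / aeval y Q - algebraMap K L c = aeval y (P - C c * Q) / aeval y Q := by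
    rw [map_sub, map_mul, aeval_C]; field_simp
  have hP : P - C c * Q ≠ 0 := by
    intro h0
    rw [h0, map_zero, zero_div, sub_eq_zero] at h1
    exact hc h1
  filter_upwards [h.eventually_map_div_sub_lt hP hQ, h.eventually_map_aeval_eq Q hQ] with a h2 h3
  have hQa := h.eval_ne_zero hQ h3
  rw [← h1] at h2
  convert h2 using 2
  have : (P - C c * Q).eval a / Q.eval a = P.eval a / Q.eval a - c := by
    rw [eval_sub, eval_mul, eval_C]; field_simp
  rw [this, (algebraMap K L).map_sub]
  ring

end IsHenselianLimit

end Growth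

/-! ### λ-freeness and the exclusion of λ-limits -/

section LambdaFree

variable {K Γ₀ : Type*} [Field K] [Differential K] [LinearOrderedCommGroupWithZero Γ₀]

/-- The conditions of `λ`-freeness for a valuation written multiplicatively. -/
structure Valuation.IsLambdaFree (v : Valuation K Γ₀) : Prop where
  ungrounded : ∀ g, g ≠ 0 → v g ≠ 1 → ∃ d, d ≠ 0 ∧ v d ≠ 1 ∧ v (logDeriv d) < v (logDeriv g)
  lambdaFree : ∀ s : K, ∃ g, 1 < v g ∧ v (logDeriv g) ≤ v (s - logDeriv (logDeriv g))

namespace Valuation.IsLambdaFree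

variable {v : Valuation K Γ₀}

/-- By ungroundedness some d ≺ 1 has d† ≺ x†. Powers of d have logarithmic derivatives of the same
size as d†, so by H-type none of them can drop to x. -/
theorem exists_lt_pow (h : v.IsLambdaFree) (hK : v.IsHAsymptotic)
    (hn : ∀ n : ℕ, n ≠ 0 → v n = 1) {x : K} (hx : x ≠ 0) (hx1 : v x < 1) (n : ℕ) :
    ∃ e, e ≠ 0 ∧ v e < 1 ∧ v x < v e ^ n := by
  rcases eq_or_ne n 0 with rfl | hn0
  · exact ⟨x, hx, hx1, by simpa using hx1⟩
  obtain ⟨d, hd, hd1, hdx⟩ : ∃ d, d ≠ 0 ∧ v d < 1 ∧ v (logDeriv d) < v (logDeriv x) := by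
    obtain ⟨d, hd, hd1, hdx⟩ := h.ungrounded x hx hx1.ne
    rcases lt_or_gt_of_ne hd1 with h1 | h1
    · exact ⟨d, hd, h1, hdx⟩
    · refine ⟨d⁻¹, inv_ne_zero hd, ?_, by rwa [IsHAsymptotic.map_logDeriv_inv]⟩
      rw [map_inv₀]
      exact inv_lt_one_of_one_lt₀ h1
  refine ⟨d, hd, hd1, ?_⟩
  by_contra hc
  rw [← map_pow, not_lt] at hc
  have := hK.map_logDeriv_le (d ^ n) x (pow_ne_zero n hd) hc hx1
  rw [Differential.logDeriv_pow, map_mul, hn n hn0, one_mul] at this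
  exact this.not_gt hdx

/-- A `λ`-free field has no gap. -/
theorem exists_lt_deriv (h : v.IsLambdaFree) (hK : v.IsHAsymptotic)
    (hn : ∀ n : ℕ, n ≠ 0 → v n = 1) {b : K} (hb : b ≠ 0)
    (hlt : ∀ g, 1 < v g → v b < v (logDeriv g)) :
    ∃ x, x ≠ 0 ∧ v x < 1 ∧ v b < v x′ := by
  -- With s = b†, the quotient z = b / g† has z† = b† - g†† ≽ g†, hence z′ ≽ z * g† = b. An x with z
  -- ≺ x ≺ 1 then makes the inequality strict.
  obtain ⟨g, hg, hgs⟩ := h.lambdaFree (logDeriv b)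
  have hbg := hlt g hg
  have hpos : 0 < v (logDeriv g) := lt_of_le_of_lt zero_le hbg
  have hg0 : logDeriv g ≠ 0 := by intro h0; simp [h0] at hpos
  set z := b / logDeriv g with hz
  have hz0 : z ≠ 0 := div_ne_zero hb hg0
  have hz1 : v z < 1 := by rw [hz, map_div₀]; exact (div_lt_one₀ hpos).2 hbg
  have hzb : v b ≤ v z′ := by
    rw [IsHAsymptotic.map_deriv v hz0, hz, Differential.logDeriv_div _ _ hb hg0, map_div₀]
    calc v b = v (logDeriv g) * (v b / v (logDeriv g)) := by
          rw [mul_div_cancel₀ _ hpos.ne']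
      _ ≤ _ := mul_le_mul_left hgs _
  obtain ⟨x, hx, hx1, hzx⟩ := h.exists_lt_pow hK hn hz0 hz1 1
  rw [pow_one] at hzx
  exact ⟨x, hx, hx1, hzb.trans_lt (hK.map_deriv_lt_map_deriv hx1.ne hzx)⟩

end Valuation.IsLambdaFree

variable {L : Type*} [Field L] [Algebra K L]

/-- `f` behaves, at the elements of `K`, like a pseudolimit of the sequence whose absence in `K`
defines `λ`-freeness. -/
def IsLambdaLimit (v : Valuation K Γ₀) (w : Valuation L Γ₀) (f : L) : Prop :=
  ∀ g : K, 1 < v g → w (f - algebraMap K L (logDeriv (logDeriv g))) < v (logDeriv g)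

variable {v : Valuation K Γ₀} {w : Valuation L Γ₀} {f y : L} {s : K} {P Q : K[X]}

theorem IsLambdaLimit.exists_le (hf : IsLambdaLimit v w f)
    (hv : ∀ a, w (algebraMap K L a) = v a) (h : v.IsLambdaFree) (c : K) :
    ∃ g, 1 < v g ∧ v (logDeriv g) ≤ w (f - algebraMap K L c) := by
  obtain ⟨g, hg, hgc⟩ := h.lambdaFree c
  refine ⟨g, hg, ?_⟩
  by_contra! hlt
  have h1 := w.map_sub_lt (hf g hg) hlt
  rw [sub_sub_sub_cancel_left, ← map_sub, hv] at h1
  exact h1.not_ge hgc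

theorem IsLambdaLimit.ne_algebraMap (hf : IsLambdaLimit v w f) (hK : v.IsHAsymptotic)
    (hv : ∀ a, w (algebraMap K L a) = v a) (h : v.IsLambdaFree) (c : K) :
    f ≠ algebraMap K L c := by
  rintro rfl
  obtain ⟨g, hg, hgc⟩ := hf.exists_le hv h c
  have hg0 : g ≠ 0 := by rintro rfl; rw [map_zero] at hg; exact not_lt_zero hg
  rw [sub_self, map_zero] at hgc
  exact hgc.not_gt (hK.map_logDeriv_pos hg0 hg.ne')

namespace IsHenselianLimit

/-- Some c = h†† in K satisfies f - c ≺ g†, and the values F(a) are eventually closer to f than c;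
the growth is bounded by one of these distances. -/
theorem eventually_growth_lt (hl : IsHenselianLimit v w y) (hK : v.IsHAsymptotic)
    (h : v.IsLambdaFree) (hQ : Q ≠ 0) (hf : IsLambdaLimit v w (aeval y P / aeval y Q))
    {g : K} (hg : g ≠ 0) (hg1 : v g ≠ 1) :
    ∀ᶠ a in approx K w y,
      growth w y P Q (w (y - algebraMap K L a)) < v (logDeriv g) * w (aeval y Q) ^ 2 := by
  have hQy : 0 < w (aeval y Q) := zero_lt_iff.2 (by simpa using hl.aeval_ne_zero hQ)
  obtain ⟨c, hc⟩ : ∃ c, w (aeval y P / aeval y Q - algebraMap K L c) < v (logDeriv g) := by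
    rcases lt_or_gt_of_ne hg1 with h1 | h1
    · refine ⟨logDeriv (logDeriv g⁻¹), ?_⟩
      rw [← Valuation.IsHAsymptotic.map_logDeriv_inv g]
      refine hf g⁻¹ ?_
      rw [map_inv₀]
      exact (one_lt_inv₀ (zero_lt_iff.2 (by simpa using hg))).2 h1
    · exact ⟨_, hf g h1⟩
  filter_upwards [hl.eventually_exists_growth_le P hQ, eventually_approx_forall
    (hl.eventually_map_div_sub_algebraMap_lt P hQ
      (hf.ne_algebraMap hK hl.map_algebraMap h c))] with a ⟨x, hx, hxg⟩ h2
  exact hxg.trans_lt (mul_lt_mul_of_pos_right ((h2 x hx).trans hc) (pow_pos hQy 2))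

/-- A rational function of `y` can be a `λ`-limit only if `y` is approximated by elements of `K`
at a slow rate. -/
theorem eventually_jammed (hl : IsHenselianLimit v w y) (hK : v.IsHAsymptotic)
    (h : v.IsLambdaFree) (hQ : Q ≠ 0) (hf : IsLambdaLimit v w (aeval y P / aeval y Q))
    {e : K} (he : e ≠ 0) (he1 : v e < 1) :
    ∀ᶠ a in approx K w y, ∀ a₁, w (y - algebraMap K L a₁) ≤ w (y - algebraMap K L a) →
      v e * w (y - algebraMap K L a) < w (y - algebraMap K L a₁) := by
  have hQy : 0 < w (aeval y Q) ^ 2 :=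
    pow_pos (zero_lt_iff.2 (by simpa using hl.aeval_ne_zero hQ)) 2
  filter_upwards [hl.eventually_growth_lt hK h hQ hf he he1.ne,
    eventually_approx_forall (hl.eventually_le_growth P hQ)] with a h1 h2 a₁ ha₁
  obtain ⟨g, hg, hgw⟩ := hf.exists_le hl.map_algebraMap h (P.eval a₁ / Q.eval a₁)
  have hg0 : g ≠ 0 := by rintro rfl; rw [map_zero] at hg; exact not_lt_zero hg
  set r := w (y - algebraMap K L a)
  set r₁ := w (y - algebraMap K L a₁)
  have hr : 0 < r := hl.pos a
  have hr₁ : 0 < r₁ := hl.pos a₁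
  have h3 : v (logDeriv g) * w (aeval y Q) ^ 2 ≤ growth w y P Q r₁ :=
    (mul_le_mul_left hgw _).trans (h2 a₁ ha₁)
  -- The distance from f to its approximation at a₁ is at least g†, while the growth at r is below
  -- e†; monotonicity of growth / r compares the two radii. Then e′ ≺ g† converts this into e * r ≺
  -- r₁.
  have h4 : (v (logDeriv g) * r) * w (aeval y Q) ^ 2
      < (v (logDeriv e) * r₁) * w (aeval y Q) ^ 2 := by
    calc (v (logDeriv g) * r) * w (aeval y Q) ^ 2
        = (v (logDeriv g) * w (aeval y Q) ^ 2) * r := mul_right_comm _ _ _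
      _ ≤ growth w y P Q r₁ * r := mul_le_mul_left h3 _
      _ ≤ growth w y P Q r * r₁ := growth_mul_le ha₁
      _ < (v (logDeriv e) * w (aeval y Q) ^ 2) * r₁ := mul_lt_mul_of_pos_right h1 hr₁
      _ = _ := mul_right_comm _ _ _
  have h5 := lt_of_mul_lt_mul_right h4 hQy.le
  have h6 := hK.map_deriv_lt_map_logDeriv he1 hg0 hg.ne'
  rw [Valuation.IsHAsymptotic.map_deriv v he] at h6
  have h7 : v (logDeriv e) * (v e * r) < v (logDeriv e) * r₁ := by
    rw [← mul_assoc]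
    exact (mul_lt_mul_of_pos_right h6 hr).trans h5
  exact lt_of_mul_lt_mul_left h7 zero_le

/-- The growth at radius 1 is realized, up to the factor from Q, in the value group of K. It is
nonzero: otherwise the growth vanishes at every radius, so F(y) = F(a) would lie in K. -/
theorem exists_growth_one_eq_map (hl : IsHenselianLimit v w y) (hK : v.IsHAsymptotic)
    (h : v.IsLambdaFree) (hQ : Q ≠ 0) (hf : IsLambdaLimit v w (aeval y P / aeval y Q)) :
    ∃ b, b ≠ 0 ∧ growth w y P Q 1 = v b * w (aeval y Q) ^ 2 := by
  obtain ⟨k, hk⟩ := exists_growth_one_eq w y P Q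
  obtain ⟨a, h1, h2, h3⟩ := ((hl.eventually_map_aeval_eq' (crossDeriv P Q k)).and
    ((hl.eventually_map_aeval_eq Q hQ).and (hl.eventually_le_growth P hQ))).exists
  have hQa := hl.eval_ne_zero hQ h2
  have hva : v (Q.eval a) ≠ 0 := by simpa using hQa
  have heq : growth w y P Q 1
      = v ((crossDeriv P Q k).eval a / Q.eval a ^ 2) * w (aeval y Q) ^ 2 := by
    rw [h2, map_div₀, map_pow, div_mul_cancel₀ _ (pow_ne_zero 2 hva), hk, h1]
  refine ⟨(crossDeriv P Q k).eval a / Q.eval a ^ 2, fun h0 => ?_, heq⟩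
  rw [h0, map_zero, zero_mul] at heq
  have h4 : growth w y P Q (w (y - algebraMap K L a)) ≤ 0 := by
    rcases le_total (w (y - algebraMap K L a)) 1 with hr | hr
    · exact (growth_mono hr).trans heq.le
    · exact (growth_le_mul_pow hr).trans (by rw [heq, zero_mul])
  have h5 := le_zero_iff.1 (h3.trans h4)
  have h6 : w (aeval y Q) ^ 2 ≠ 0 := pow_ne_zero 2 (by rwa [h2])
  have h7 := (mul_eq_zero.1 h5).resolve_right h6
  rw [map_eq_zero, sub_eq_zero] at h7
  exact hf.ne_algebraMap hK hl.map_algebraMap h _ h7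

end IsHenselianLimit

variable [Differential L] [DifferentialAlgebra K L]

/-- No element of `K (y)` is a `λ`-limit, for a large integral `y`. -/
theorem IsLargeIntegral.not_isLambdaLimit (hi : IsLargeIntegral v w s y)
    (hl : IsHenselianLimit v w y) (h : v.IsLambdaFree) (hQ : Q ≠ 0) :
    ¬ IsLambdaLimit v w (aeval y P / aeval y Q) := by
  intro hf
  have hK := hi.hAsymptotic.comap hi.map_algebraMap
  have hn := hl.map_natCast
  have hQy : 0 < w (aeval y Q) ^ 2 :=
    pow_pos (zero_lt_iff.2 (by simpa using hl.aeval_ne_zero hQ)) 2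
  have hne : ∀ g : K, 1 < v g → g ≠ 0 := by
    rintro g hg rfl
    rw [map_zero] at hg
    exact not_lt_zero hg
  -- Either the distances y - a stay above some fixed b ≻ 1, or they fall below every such b while
  -- remaining ≻ 1.
  by_cases hcof : ∃ b, 1 < v b ∧ ∀ a, v b ≤ w (y - algebraMap K L a)
  · obtain ⟨b, hb, hba⟩ := hcof
    have hb0 := hne b hb
    obtain ⟨d, hd, hd1, hdb⟩ := h.ungrounded b hb0 hb.ne'
    have hbpos := hK.map_logDeriv_pos hb0 hb.ne'
    have hdpos := hK.map_logDeriv_pos hd hd1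
    -- The slow rate is applied with e = d† / b†. It gives (y - a) * d† ≺ b₁ * b†, and b† ≼ b₁† by
    -- H-type since b ≼ b₁; but the definite improvement says b₁ * b₁† ≺ (y - a) * d†.
    have he0 : logDeriv d / logDeriv b ≠ 0 := by
      rw [← v.ne_zero_iff, map_div₀]
      exact (div_pos hdpos hbpos).ne'
    have he1 : v (logDeriv d / logDeriv b) < 1 := by
      rw [map_div₀]; exact (div_lt_one₀ hbpos).2 hdb
    obtain ⟨a, ha⟩ := (hl.eventually_jammed hK h hQ hf he0 he1).exists
    obtain ⟨a₁, b₁, hb₁, hyb₁, hg⟩ := hi.exists_better a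
    have hg1 := hg b₁ (hne b₁ hb₁) hb₁.ne'
    have hle : w (y - algebraMap K L a₁) ≤ w (y - algebraMap K L a) := by
      rw [hyb₁]
      exact (lt_of_mul_lt_mul_right hg1 zero_le).le
    have h1 := ha a₁ hle
    have h2 := hK.map_logDeriv_le_of_one_lt hb (hyb₁ ▸ hba a₁)
    have h3 := hg d hd hd1
    rw [hyb₁, map_div₀] at h1
    have h4 := mul_lt_mul_of_pos_right h1 hbpos
    have h5 : v (logDeriv d) / v (logDeriv b) * w (y - algebraMap K L a) * v (logDeriv b)
        = w (y - algebraMap K L a) * v (logDeriv d) := by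
      rw [mul_right_comm, div_mul_cancel₀ _ hbpos.ne', mul_comm]
    rw [h5] at h4
    exact (h4.trans_le (mul_le_mul_right h2 _)).not_gt h3
  · push Not at hcof
    obtain ⟨b, hb, hbg⟩ := hl.exists_growth_one_eq_map hK h hQ hf
    have hlt : ∀ g, 1 < v g → v b < v (logDeriv g) := fun g hg => by
      obtain ⟨a, ha⟩ := (hl.eventually_growth_lt hK h hQ hf (hne g hg) hg.ne').exists
      have h1 := (growth_mono (hi.one_lt a).le).trans_lt ha
      rw [hbg] at h1
      exact lt_of_mul_lt_mul_right h1 hQy.le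
    -- Now b lies below all g†, so the absence of a gap puts it below x′ for some x ≺ 1. This leaves
    -- room for a factor e ^ (-N), and y - a ≼ 1 / e bounds the growth at y - a, up to the factor
    -- from Q, by x′, which is ≺ g† for all g ≻ 1.
    obtain ⟨x, hx, hx1, hbx⟩ := h.exists_lt_deriv hK hn hb hlt
    have hxpos : 0 < v x′ := lt_of_le_of_lt zero_le hbx
    have hx0 : x′ ≠ 0 := by intro h0; simp [h0] at hxpos
    obtain ⟨e, he, he1, hen⟩ := h.exists_lt_pow hK hn (x := b / x′) (div_ne_zero hb hx0)
      (by rw [map_div₀]; exact (div_lt_one₀ hxpos).2 hbx) (max P.natDegree Q.natDegree)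
    have hepos : 0 < v e := zero_lt_iff.2 (by simpa using he)
    obtain ⟨a₀, ha₀⟩ := hcof e⁻¹ (by
      rw [map_inv₀]; exact (one_lt_inv₀ hepos).2 he1)
    obtain ⟨a, h1, h2⟩ := ((hl.eventually_lt a₀).and (hl.eventually_le_growth P hQ)).exists
    obtain ⟨g, hg, hgw⟩ := hf.exists_le hl.map_algebraMap h (P.eval a / Q.eval a)
    set N := max P.natDegree Q.natDegree
    set r := w (y - algebraMap K L a)
    have hr : r ≤ (v e)⁻¹ := by
      rw [← map_inv₀]
      exact (h1.trans ha₀).le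
    have h3 : v (logDeriv g) * w (aeval y Q) ^ 2 ≤ (v b * r ^ N) * w (aeval y Q) ^ 2 := by
      calc v (logDeriv g) * w (aeval y Q) ^ 2 ≤ growth w y P Q r :=
            (mul_le_mul_left hgw _).trans h2
        _ ≤ growth w y P Q 1 * r ^ N := growth_le_mul_pow (hi.one_lt a).le
        _ = _ := by rw [hbg, mul_right_comm]
    have h4 : v (logDeriv g) ≤ v b * r ^ N := le_of_mul_le_mul_right h3 hQy
    have h5 : v b * r ^ N ≤ v x′ := by
      rw [map_div₀, div_lt_iff₀ hxpos] at hen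
      calc v b * r ^ N ≤ v b * (v e)⁻¹ ^ N :=
            mul_le_mul_right (pow_le_pow_left₀ zero_le hr N) _
        _ ≤ (v e ^ N * v x′) * (v e)⁻¹ ^ N := mul_le_mul_left hen.le _
        _ = v x′ := by
          rw [mul_right_comm, ← mul_pow, mul_inv_cancel₀ hepos.ne', one_pow, one_mul]
    exact (h4.trans h5).not_gt (hK.map_deriv_lt_map_logDeriv hx1 (hne g hg) hg.ne')

end LambdaFree

/-! ### Translation between additive and multiplicative valuations -/

section ValuationSubring

variable {K : Type*} [Field K] {O : ValuationSubring K}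

theorem valn_le_valn_iff {a b : K} : valn O a ≤ valn O b ↔ O.valuation b ≤ O.valuation a :=
  Iff.rfl

theorem valn_lt_valn_iff {a b : K} : valn O a < valn O b ↔ O.valuation b < O.valuation a :=
  Iff.rfl

theorem valn_eq_valn_iff {a b : K} : valn O a = valn O b ↔ O.valuation a = O.valuation b :=
  Iff.rfl

theorem valn_pos_iff {a : K} : 0 < valn O a ↔ O.valuation a < 1 := by
  rw [← (valn O).map_one, valn_lt_valn_iff, map_one]

theorem valn_neg_iff {a : K} : valn O a < 0 ↔ 1 < O.valuation a := by
  rw [← (valn O).map_one, valn_lt_valn_iff, map_one]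

theorem valn_eq_zero_iff {a : K} : valn O a = 0 ↔ O.valuation a = 1 := by
  rw [← (valn O).map_one, valn_eq_valn_iff, map_one]

theorem valn_nonneg_iff {a : K} : 0 ≤ valn O a ↔ O.valuation a ≤ 1 := by
  rw [← (valn O).map_one, valn_le_valn_iff, map_one]

theorem exists_valn_eq {γ : ValGrpTop O} (hγ : γ ≠ ⊤) : ∃ g, g ≠ 0 ∧ valn O g = γ := by
  obtain ⟨g, rfl⟩ := val_surjective O γ
  exact ⟨g, fun h => hγ (by rw [h, AddValuation.map_zero]), rfl⟩

variable [Differential K]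

theorem IsAsymptoticField.not_isGrounded_iff (h : IsAsymptoticField O) :
    ¬ IsGrounded O ↔ ∀ g, g ≠ 0 → O.valuation g ≠ 1 →
      ∃ d, d ≠ 0 ∧ O.valuation d ≠ 1 ∧ O.valuation (logDeriv d) < O.valuation (logDeriv g) := by
  constructor
  · intro hO g hg hg1
    by_contra! hcon
    rw [ne_eq, ← valn_eq_zero_iff] at hg1
    refine hO ⟨psi O (valn O g), ⟨valn O g, hg1, val_ne_top O hg, rfl⟩, ?_⟩
    rintro β ⟨γ, hγ0, hγt, rfl⟩
    obtain ⟨d, hd, rfl⟩ := exists_valn_eq hγt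
    rw [h.psi_val hd hγ0, h.psi_val hg hg1, valn_le_valn_iff]
    exact hcon d hd (by rwa [ne_eq, ← valn_eq_zero_iff])
  · rintro hO ⟨β, ⟨γ, hγ0, hγt, rfl⟩, hub⟩
    obtain ⟨g, hg, rfl⟩ := exists_valn_eq hγt
    obtain ⟨d, hd, hd1, hdg⟩ := hO g hg (by rwa [ne_eq, ← valn_eq_zero_iff])
    rw [ne_eq, ← valn_eq_zero_iff] at hd1
    have := hub ⟨valn O d, hd1, val_ne_top O hd, rfl⟩
    rw [h.psi_val hd hd1, h.psi_val hg hγ0, valn_le_valn_iff] at this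
    exact this.not_gt hdg

theorem IsHAsymptoticField.isHAsymptotic (h : IsHAsymptoticField O) :
    O.valuation.IsHAsymptotic where
  lt_iff f g hf hg hf1 hg1 := by
    have := h.asymp f g hf hg (valn_pos_iff.2 hf1) (valn_pos_iff.2 hg1)
    rwa [valn_lt_valn_iff, valn_lt_valn_iff] at this
  map_logDeriv_le f g hf hfg hg1 := by
    have hg : g ≠ 0 := by
      rintro rfl
      rw [map_zero, le_zero_iff, map_eq_zero] at hfg
      exact hf hfg
    have := h.hType (valn O g) (valn O f) (valn_pos_iff.2 hg1) (valn_le_valn_iff.2 hfg)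
      (val_ne_top O hf)
    rwa [h.psi_val hf (valn_pos_iff.2 (hfg.trans_lt hg1)).ne',
      h.psi_val hg (valn_pos_iff.2 hg1).ne', valn_le_valn_iff] at this

theorem IsAsymptoticField.valuation_natCast (h : IsAsymptoticField O) (n : ℕ) (hn : n ≠ 0) :
    O.valuation n = 1 := by
  have := h.charZero
  have h0 : (n : K) ≠ 0 := by exact_mod_cast hn
  refine le_antisymm ((O.valuation_le_one_iff _).2 (by simp)) ?_
  have h1 : O.valuation (n : K)⁻¹ ≤ 1 :=
    (O.valuation_le_one_iff _).2 (by simpa using h.rat_mem (n : ℚ)⁻¹)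
  rw [map_inv₀] at h1
  exact (inv_le_one₀ (zero_lt_iff.2 (by simpa using h0))).1 h1

theorem IsAsymptoticField.exists_deriv_of_mem_negDerived (h : IsAsymptoticField O) {x : K}
    (hx : valn O x ∈ negDerived O) : ∃ b, 1 < O.valuation b ∧ O.valuation x = O.valuation b′ := by
  obtain ⟨γ, hγ, hxγ⟩ := hx
  obtain ⟨b, hb, rfl⟩ := exists_valn_eq (ne_top_of_lt hγ)
  refine ⟨b, valn_neg_iff.1 hγ, ?_⟩
  rw [h.psi_val hb hγ.ne, add_comm, val_logDeriv O hb] at hxγ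
  exact valn_eq_valn_iff.1 hxγ

end ValuationSubring

/-! ### Extensions of valuation rings and immediacy -/

section Extension

variable {K L : Type*} [Field K] [Field L] [Algebra K L] {OK : ValuationSubring K}
  {OL : ValuationSubring L}

theorem ExtendsValuation.valuation_le_iff (h : ExtendsValuation OK OL) (a b : K) :
    OL.valuation.comap (algebraMap K L) a ≤ OL.valuation.comap (algebraMap K L) b ↔
      OK.valuation a ≤ OK.valuation b := by
  rw [Valuation.comap_apply, Valuation.comap_apply]
  rcases eq_or_ne b 0 with rfl | hb
  · simp
  have h1 := h (a / b)
  rw [← ValuationSubring.valuation_le_one_iff, ← ValuationSubring.valuation_le_one_iff, map_div₀,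
    map_div₀, map_div₀, div_le_one₀ (zero_lt_iff.2 (by simpa using hb)),
    div_le_one₀ (zero_lt_iff.2 (by simpa using hb))] at h1
  exact h1

theorem ExtendsValuation.isEquiv (h : ExtendsValuation OK OL) :
    (OL.valuation.comap (algebraMap K L)).IsEquiv OK.valuation :=
  fun a b => h.valuation_le_iff a b

/-- An extension is immediate if every nonzero element is asymptotic to an element of the base
field. -/
theorem ExtendsValuation.isImmediateExtension (h : ExtendsValuation OK OL)
    (hc : ∀ f : L, f ≠ 0 →
      ∃ c, OL.valuation (f - algebraMap K L c) < OL.valuation f) :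
    IsImmediateExtension OK OL := by
  have heq : ∀ {f : L} {c : K}, OL.valuation (f - algebraMap K L c) < OL.valuation f →
      OL.valuation (algebraMap K L c) = OL.valuation f := fun {f c} hfc => by
    have := OL.valuation.map_sub_eq_of_lt_left hfc
    rwa [sub_sub_cancel] at this
  refine ⟨h, fun f hf => ?_, fun f hf => ?_⟩
  · obtain ⟨c, hfc⟩ := hc f hf
    exact ⟨c, valn_eq_valn_iff.2 (heq hfc).symm⟩
  · rcases eq_or_ne f 0 with rfl | hf0
    · exact ⟨0, OK.zero_mem, valn_pos_iff.2 (by simp)⟩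
    obtain ⟨c, hfc⟩ := hc f hf0
    have hf1 := (OL.valuation_le_one_iff f).2 hf
    refine ⟨c, (h c).1 ?_, valn_pos_iff.2 (hfc.trans_le hf1)⟩
    rwa [← ValuationSubring.valuation_le_one_iff, heq hfc]

variable [Differential K]

theorem IsLambdaFree.isLambdaFree_comap (h : IsLambdaFree OK) (hE : ExtendsValuation OK OL) :
    (OL.valuation.comap (algebraMap K L)).IsLambdaFree where
  ungrounded g hg hg1 := by
    have hE := hE.isEquiv
    obtain ⟨d, hd, hd1, hdg⟩ := h.toIsAsymptoticField.not_isGrounded_iff.1 h.ungrounded g hg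
      (fun h1 => hg1 (hE.eq_one_iff_eq_one.2 h1))
    exact ⟨d, hd, fun h1 => hd1 (hE.eq_one_iff_eq_one.1 h1), hE.lt_iff_lt.2 hdg⟩
  lambdaFree s := by
    obtain ⟨g, hg, hgs⟩ := h.lambdaFree s
    exact ⟨g, hE.isEquiv.one_lt_iff_one_lt.2 (valn_neg_iff.1 hg),
      hE.isEquiv.symm.le_iff_le.1 (valn_le_valn_iff.1 hgs)⟩

variable [Differential L] [DifferentialAlgebra K L]

/-- Elements of equal nonzero value have logarithmic derivatives of equal value, so an extension
with the same value group has the same ψ. -/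
theorem IsImmediateExtension.not_isGrounded (h : IsImmediateExtension OK OL)
    (hK : IsAsymptoticField OK) (hL : IsAsymptoticField OL) (hg : ¬ IsGrounded OK) :
    ¬ IsGrounded OL := by
  have hE := h.extendsValuation.isEquiv
  rw [hL.not_isGrounded_iff]
  intro g hg0 hg1
  obtain ⟨a, ha⟩ := h.valueGroup g hg0
  have ha0 : a ≠ 0 := by
    rintro rfl
    rw [map_zero, AddValuation.map_zero] at ha
    exact val_ne_top OL hg0 ha
  have hag := hL.val_logDeriv_congr hg0 (by simpa using ha0) ha
    (by rwa [ne_eq, valn_eq_zero_iff])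
  rw [valn_eq_valn_iff] at ha hag
  obtain ⟨d, hd, hd1, hda⟩ := hK.not_isGrounded_iff.1 hg a ha0 (fun h1 => hg1 (by
    rw [ha]; exact hE.eq_one_iff_eq_one.2 h1))
  refine ⟨algebraMap K L d, by simpa using hd, fun h1 => hd1 (hE.eq_one_iff_eq_one.1 h1), ?_⟩
  rw [hag, Differential.logDeriv_algebraMap, Differential.logDeriv_algebraMap]
  exact hE.lt_iff_lt.2 hda

end Extension

/-! ### The proposition -/

theorem mainTheorem6 {K L : Type*} [Field K] [Differential K] [Field L] [Differential L]
    [Algebra K L] [DifferentialAlgebra K L]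
    (OK : ValuationSubring K) (hK_henselian : HenselianLocalRing OK)
    (hK_preDValued : IsPreDValuedField OK) (hK_hType : IsHType OK)
    (s : K) (hs : {γ | ∃ a : K, γ = valn OK (s - a′)} ⊆ negDerived OK)
    (y : L) (hy_trans : Transcendental K y) (hL_gen : IntermediateField.adjoin K {y} = ⊤)
    (hy_deriv : y′ = algebraMap K L s)
    (OL : ValuationSubring L) (hL_ext : ExtendsValuation OK OL)
    (hL_hAsymptotic : IsHAsymptoticField OL) :
    IsImmediateExtension OK OL ∧ valn OL y < 0 ∧ (IsLambdaFree OK → IsLambdaFree OL) := by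
  set w := OL.valuation with hw
  -- Restricting w, instead of using the valuation of `OK`, puts the values of K and L in one
  -- ordered group; the two valuations on K are equivalent.
  set v := w.comap (algebraMap K L) with hv
  have hE : v.IsEquiv OK.valuation := hL_ext.isEquiv
  have hi : IsLargeIntegral v w s y := by
    refine ⟨hL_hAsymptotic.isHAsymptotic, fun _ => rfl, fun f g hf hg hf1 hg1 => ?_, hy_deriv,
      fun a => ?_⟩
    · exact hE.lt_iff_lt.2 (valn_lt_valn_iff.1 (hK_preDValued.pdv f g hf hg
        (valn_nonneg_iff.2 (hE.le_one_iff_le_one.1 hf1))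
        (valn_pos_iff.2 (hE.lt_one_iff_lt_one.1 hg1))))
    · obtain ⟨b, hb, hab⟩ := hK_preDValued.exists_deriv_of_mem_negDerived (hs ⟨a, rfl⟩)
      exact ⟨b, hE.one_lt_iff_one_lt.2 hb, hE.eq_iff.2 hab⟩
  have hl : IsHenselianLimit v w y := by
    refine ⟨fun _ => rfl, fun n hn => ?_, fun Q h0 h1 h2 => ?_, fun a => ?_,
      hi.exists_map_sub_lt⟩
    · rw [hv, Valuation.comap_apply, map_natCast]
      exact hL_hAsymptotic.valuation_natCast n hn
    · exact OK.exists_isRoot_of_coeff hK_henselian Q (fun i => hE.le_one_iff_le_one.1 (h0 i))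
        (hE.lt_one_iff_lt_one.1 h1) fun i hi => hE.lt_one_iff_lt_one.1 (h2 i hi)
    · obtain ⟨b, -, -, hb⟩ := hi.exists_map_sub_eq a
      exact ⟨b, hb⟩
  have hrat : ∀ f : L, ∃ P Q : K[X], Q ≠ 0 ∧ f = aeval y P / aeval y Q := fun f => by
    obtain ⟨P, Q, hf⟩ := (IntermediateField.mem_adjoin_simple_iff K f).1
      (hL_gen ▸ IntermediateField.mem_top)
    rcases eq_or_ne Q 0 with rfl | hQ
    -- A zero denominator gives f = 0 by the convention for division, so f is rewritten as 0 / 1.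
    · exact ⟨0, 1, one_ne_zero, by simpa using hf⟩
    · exact ⟨P, Q, hQ, hf⟩
  have himm : IsImmediateExtension OK OL := by
    refine hL_ext.isImmediateExtension fun f hf => ?_
    obtain ⟨P, Q, hQ, rfl⟩ := hrat f
    have hP : P ≠ 0 := by rintro rfl; simp at hf
    obtain ⟨a, ha⟩ := (hl.eventually_map_div_sub_lt hP hQ).exists
    exact ⟨_, ha⟩
  refine ⟨himm, valn_neg_iff.2 (by simpa using hi.one_lt 0), fun hfree => ?_⟩
  refine ⟨hL_hAsymptotic, himm.not_isGrounded hK_preDValued.toIsAsymptoticField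
    hL_hAsymptotic.toIsAsymptoticField hfree.ungrounded, ?_, fun f => ?_⟩
  · have h0 : y ≠ 0 := by
      rintro rfl
      exact hl.aeval_ne_zero (P := X) X_ne_zero (by simp)
    exact ⟨valn OL y, (valn_neg_iff.2 (by simpa using hi.one_lt 0)).ne, val_ne_top OL h0⟩
  · obtain ⟨P, Q, hQ, rfl⟩ := hrat f
    -- The witness g for λ-freeness of L at f can be taken in K, since f is not a λ-limit over K.
    have hnot := hi.not_isLambdaLimit (P := P) hl (hfree.isLambdaFree_comap hL_ext) hQ
    simp only [IsLambdaLimit, not_forall, not_lt] at hnot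
    obtain ⟨g, hg, hgf⟩ := hnot
    refine ⟨algebraMap K L g, valn_neg_iff.2 hg, valn_le_valn_iff.2 ?_⟩
    rw [Differential.logDeriv_algebraMap, Differential.logDeriv_algebraMap]
    exact hgf
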